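/- Let $N=(S,\Sigma,F,m_0)$ be a net system (finite 1-safe Petri net): $S$, $\Sigma$ are disjoint finite sets of places and transitions, $F\subseteq (S\times\Sigma)\cup(\Sigma\times S)$, $m_0\subseteq S$; write ${}^\bullet a$, $a^\bullet$ for the pre- and postset of $a\in\Sigma$. For $m,m'\subseteq S$ put $m\xrightarrow{a}m'$ if ${}^\bullet a\subseteq m$, $(a^\bullet\setminus{}^\bullet a)\cap m=\varnothing$ and $m'=(m\setminus{}^\bullet a)\cup a^\bullet$; extend this to words. Let $(a,b)\in I$ iff $a\neq b$ and $({}^\bullet a\cup a^\bullet)\cap({}^\bullet b\cup b^\bullet)=\varnothing$, and let $\langle\sigma\rangle$ be the Mazurkiewicz trace of $\sigma\in\Sigma^*$ over $(\Sigma,I)$, with prefix order $\sqsubseteq$. A firing trace is the trace of a word that can fire at $m_0$; a trace is prime if its words are non-empty and all have the same last letter. The event structure unfolding $\mathcal E_N$ is the $\Sigma$-labeled event structure whose events are the prime firing traces, ordered by $\sqsubseteq$, two events being in conflict iff no firing trace has both as prefixes, and each event being labeled by its last letter. Let $X_N$ be the directed labeled square complex whose 1-skeleton is the connected component of $m_0$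 in the graph of all markings with the arcs $m\xrightarrow{a}m'$ as edges (directed from $m$ to $m'$, labeled $a$; loops and parallel edges allowed), and whose squares are given by the arcs $m\xrightarrow{a}m_1\xrightarrow{b}m'$, $m\xrightarrow{b}m_2\xrightarrow{a}m'$ with $(a,b)\in I$. Let $\varphi:\widetilde X_N\to X_N$ be a universal cover (a simply connected covering, with lifted directions and labels), let $\widetilde m_0$ be any lift of $m_0$, and let $\mathcal F(\widetilde m_0)$ be the principal filter of $\widetilde m_0$, that is, the set of vertices reachable from $\widetilde m_0$ by directed paths, ordered by directed reachability and with the labeled directed edges of $\widetilde X_N$. Then there is a $\Sigma$-labeled event structure $\mathcal E_{X_N}$ whose domain (the set of its configurations ordered by inclusion, with each Hasse edge $(c,c\cup\{e\})$ labeled by the label of $e$) is isomorphic to $\mathcal F(\widetilde m_0)$, and for every such $\mathcal E_{X_N}$ the labeled event structures $\mathcal E_N$ and $\mathcal E_{X_N}$ are isomorphic. More precisely, call a word geodesic for a configuration $c$ of $\mathcal E_{X_N}$ if it is the word of labels of a shortest path from $\varnothing$ to $c$ in the undirected Hasse diagram of the domain, and call the traces of such words geodesic traces. Then the geodesic traces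 of $\mathcal E_{X_N}$ are exactly the firing traces of $N$; there is a bijection $c\mapsto g(c)$ from the configurations of $\mathcal E_{X_N}$ to the firing traces of $N$ such that a word is geodesic for $c$ iff its trace is $g(c)$; and the isomorphism $f:\mathcal E_N\to\mathcal E_{X_N}$ can be chosen such that $g(\downarrow f(e))=e$ for every event $e$ of $\mathcal E_N$, where $\downarrow e'$ denotes the set of events $\le e'$. -/

import Mathlib

universe u v w x u₂ v₂

/-! ### Labeled event structures, their configurations and domains -/

/-- A `Λ`-labeled event structure `(E, ≤, #, λ)`. -/
structure LabeledEventStructure (Λ : Type v) where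
  Event : Type u
  le : Event → Event → Prop
  conflict : Event → Event → Prop
  label : Event → Λ
  le_refl : ∀ e, le e e
  le_trans : ∀ e e' e'', le e e' → le e' e'' → le e e''
  le_antisymm : ∀ e e', le e e' → le e' e → e = e'
  conflict_irrefl : ∀ e, ¬ conflict e e
  conflict_symm : ∀ e e', conflict e e' → conflict e' e
  finite_below : ∀ e, {e' | le e' e}.Finite
  conflict_of_le : ∀ e e' e'', conflict e e' → le e' e'' → conflict e e''

namespace LabeledEventStructure

/-- An isomorphism of labeled event structures. -/
structure Iso {Λ : Type v} (E₁ : LabeledEventStructure.{u} Λ) (E₂ : LabeledEventStructure.{w} Λ)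
    where
  toEquiv : E₁.Event ≃ E₂.Event
  le_iff : ∀ e e', E₁.le e e' ↔ E₂.le (toEquiv e) (toEquiv e')
  conflict_iff : ∀ e e', E₁.conflict e e' ↔ E₂.conflict (toEquiv e) (toEquiv e')
  label_eq : ∀ e, E₂.label (toEquiv e) = E₁.label e

/-- A configuration: a finite, conflict-free, downward-closed set of events. -/
structure Config {Λ : Type v} (E : LabeledEventStructure.{u} Λ) where
  carrier : Set E.Event
  finite : carrier.Finite
  conflictFree : ∀ e ∈ carrier, ∀ e' ∈ carrier, ¬ E.conflict e e'
  downClosed : ∀ e ∈ carrier, ∀ e', E.le e' e → e' ∈ carrier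

variable {Λ : Type v} (E : LabeledEventStructure.{u} Λ)

/-- The empty configuration. -/
def emptyConfig : E.Config where
  carrier := ∅
  finite := Set.finite_empty
  conflictFree := by simp
  downClosed := by simp

/-- The configuration `↓e`. -/
def below (e : E.Event) : E.Config where
  carrier := {e' | E.le e' e}
  finite := E.finite_below e
  conflictFree := fun a ha b hb hab =>
    E.conflict_irrefl e <|
      E.conflict_of_le e a e
        (E.conflict_symm a e (E.conflict_of_le a b e hab hb)) ha
  downClosed := fun a ha b hb => E.le_trans b a e hb ha

/-- `(c, c')` is a directed edge, labeled `a`, of the Hasse diagram of the domain: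
`c' = c ∪ {e}` for an event `e ∉ c` with label `a`. -/
def HasseEdge (c : E.Config) (a : Λ) (c' : E.Config) : Prop :=
  ∃ e, e ∉ c.carrier ∧ c'.carrier = insert e c.carrier ∧ E.label e = a

/-- `σ` is the word of labels of a path from `c` to `c'` in the (undirected) covering graph
`G(E)` of the domain. -/
def PathWord : E.Config → List Λ → E.Config → Prop
  | c, [], c' => c = c'
  | c, a :: σ, c' => ∃ d, (E.HasseEdge c a d ∨ E.HasseEdge d a c) ∧ PathWord d σ c'

/-- `σ` is the word of labels of a shortest path of `G(E)` from `∅` to `c`. -/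
def IsGeodesicWord (c : E.Config) (σ : List Λ) : Prop :=
  E.PathWord E.emptyConfig σ c ∧ ∀ τ, E.PathWord E.emptyConfig τ c → σ.length ≤ τ.length

end LabeledEventStructure

/-! ### Mazurkiewicz traces -/

/-- An independence relation on an alphabet. -/
structure TraceAlphabet (A : Type v) where
  indep : A → A → Prop
  irrefl : ∀ a, ¬ indep a a
  symm : ∀ a b, indep a b → indep b a

namespace TraceAlphabet

variable {A : Type v} (M : TraceAlphabet A)

/-- `σ a b σ' ↔ σ b a σ'` for independent letters `a`, `b`. -/
def Swap (x y : List A) : Prop :=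
  ∃ (σ σ' : List A) (a b : A), M.indep a b ∧
    x = σ ++ a :: b :: σ' ∧ y = σ ++ b :: a :: σ'

/-- The equivalence relation `∼_I`: the reflexive and transitive closure of `Swap`. -/
def wordSetoid : Setoid (List A) where
  r := Relation.ReflTransGen M.Swap
  iseqv :=
    { refl := fun _ => Relation.ReflTransGen.refl
      symm := fun h => by
        induction h with
        | refl => exact Relation.ReflTransGen.refl
        | tail _ h ih =>
          obtain ⟨σ, σ', a, b, hab, h₁, h₂⟩ := h
          exact Relation.ReflTransGen.head ⟨σ, σ', b, a, M.symm a b hab, h₂, h₁⟩ ih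
      trans := fun h₁ h₂ => h₁.trans h₂ }

/-- Mazurkiewicz traces. -/
def Trace : Type v := Quotient M.wordSetoid

/-- The trace `⟨σ⟩` of a word. -/
def trace (σ : List A) : M.Trace := Quotient.mk M.wordSetoid σ

/-- The prefix relation `⊑` on traces. -/
def Prefix (s t : M.Trace) : Prop :=
  ∃ σ τ : List A, M.trace σ = s ∧ M.trace τ = t ∧ σ <+: τ

/-- A trace is prime if its words are non-null and all have the same last letter. -/
def IsPrime (t : M.Trace) : Prop :=
  ∃ a, ∀ σ, M.trace σ = t → σ.getLast? = some a

theorem trace_eq_iff {σ τ : List A} : M.trace σ = M.trace τ ↔ Relation.ReflTransGen M.Swap σ τ :=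
  ⟨fun h => Quotient.exact h, fun h => Quotient.sound h⟩

theorem length_eq {σ τ : List A} (h : Relation.ReflTransGen M.Swap σ τ) :
    σ.length = τ.length := by
  induction h with
  | refl => rfl
  | tail _ h ih =>
    obtain ⟨σ, σ', a, b, _, h₁, h₂⟩ := h
    rw [ih, h₁, h₂]; simp

theorem append_right {σ τ : List A} (h : Relation.ReflTransGen M.Swap σ τ) (ρ : List A) :
    Relation.ReflTransGen M.Swap (σ ++ ρ) (τ ++ ρ) := by
  induction h with
  | refl => exact Relation.ReflTransGen.refl
  | tail _ h ih =>
    obtain ⟨α, β, a, b, hab, h₁, h₂⟩ := h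
    exact ih.tail ⟨α, β ++ ρ, a, b, hab, by simp [h₁], by simp [h₂]⟩

theorem prefix_iff {σ τ : List A} :
    M.Prefix (M.trace σ) (M.trace τ) ↔ ∃ ρ, M.trace (σ ++ ρ) = M.trace τ := by
  constructor
  · rintro ⟨σ', τ', h₁, h₂, ρ, rfl⟩
    refine ⟨ρ, ?_⟩
    rw [← h₂]
    exact (M.trace_eq_iff.2 (M.append_right (M.trace_eq_iff.1 h₁) ρ)).symm
  · rintro ⟨ρ, h⟩
    exact ⟨σ, σ ++ ρ, rfl, h, ρ, rfl⟩

theorem exists_trace (t : M.Trace) : ∃ σ, M.trace σ = t := Quotient.exists_rep t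

theorem prefix_refl (t : M.Trace) : M.Prefix t t := by
  obtain ⟨σ, rfl⟩ := M.exists_trace t
  exact ⟨σ, σ, rfl, rfl, List.prefix_refl σ⟩

theorem prefix_trans {r s t : M.Trace} (h : M.Prefix r s) (h' : M.Prefix s t) :
    M.Prefix r t := by
  obtain ⟨ρ, rfl⟩ := M.exists_trace r
  obtain ⟨σ, rfl⟩ := M.exists_trace s
  obtain ⟨τ, rfl⟩ := M.exists_trace t
  obtain ⟨α, hα⟩ := M.prefix_iff.1 h
  obtain ⟨β, hβ⟩ := M.prefix_iff.1 h'
  refine M.prefix_iff.2 ⟨α ++ β, ?_⟩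
  rw [← hβ, ← List.append_assoc]
  exact M.trace_eq_iff.2 (M.append_right (M.trace_eq_iff.1 hα) β)

theorem prefix_antisymm {s t : M.Trace} (h : M.Prefix s t) (h' : M.Prefix t s) : s = t := by
  obtain ⟨σ, rfl⟩ := M.exists_trace s
  obtain ⟨τ, rfl⟩ := M.exists_trace t
  obtain ⟨α, hα⟩ := M.prefix_iff.1 h
  obtain ⟨β, hβ⟩ := M.prefix_iff.1 h'
  have h₁ := M.length_eq (M.trace_eq_iff.1 hα)
  have h₂ := M.length_eq (M.trace_eq_iff.1 hβ)
  simp only [List.length_append] at h₁ h₂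
  have : α = [] := List.length_eq_zero_iff.1 (by omega)
  subst this
  simpa using hα

theorem finite_prefix [Finite A] (t : M.Trace) : {s | M.Prefix s t}.Finite := by
  obtain ⟨τ, rfl⟩ := M.exists_trace t
  refine ((List.finite_length_le A τ.length).image M.trace).subset ?_
  rintro s hs
  obtain ⟨σ, rfl⟩ := M.exists_trace s
  obtain ⟨ρ, hρ⟩ := M.prefix_iff.1 hs
  have h₁ := M.length_eq (M.trace_eq_iff.1 hρ)
  simp only [List.length_append] at h₁
  exact ⟨σ, by change σ.length ≤ τ.length; omega, rfl⟩

end TraceAlphabet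

/-- The set of geodesic traces of a labeled event structure over a trace alphabet. -/
def LabeledEventStructure.geodesicTraces {A : Type v} (E : LabeledEventStructure.{u} A)
    (M : TraceAlphabet A) : Set M.Trace :=
  {t | ∃ c σ, E.IsGeodesicWord c σ ∧ M.trace σ = t}

/-! ### Net systems and their event structure unfoldings -/

/-- A net system with places `S` and transitions `T`: a flow relation
`F ⊆ (S × T) ∪ (T × S)` and an initial marking. -/
structure NetSystem (S : Type u) (T : Type v) where
  flow : Set (S × T ⊕ T × S)
  initial : Set S

namespace NetSystem

variable {S : Type u} {T : Type v} (N : NetSystem S T)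

/-- The preset of a transition. -/
def pre (a : T) : Set S := {s | Sum.inl (s, a) ∈ N.flow}

/-- The postset of a transition. -/
def post (a : T) : Set S := {s | Sum.inr (a, s) ∈ N.flow}

/-- The firing rule `m --a--> m'`. -/
def Fires (m : Set S) (a : T) (m' : Set S) : Prop :=
  N.pre a ⊆ m ∧ (N.post a \ N.pre a) ∩ m = ∅ ∧ m' = (m \ N.pre a) ∪ N.post a

/-- The firing rule `m --σ--> m'` for words. -/
def FiresWord : Set S → List T → Set S → Prop
  | m, [], m' => m = m'
  | m, a :: σ, m' => ∃ m₁, N.Fires m a m₁ ∧ FiresWord m₁ σ m'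

/-- The trace alphabet of a net system: two distinct transitions are independent if the sets
of places around them are disjoint. -/
def alphabet : TraceAlphabet T where
  indep a b := a ≠ b ∧ (N.pre a ∪ N.post a) ∩ (N.pre b ∪ N.post b) = ∅
  irrefl := fun _ h => h.1 rfl
  symm := fun _ _ h => ⟨h.1.symm, by rw [Set.inter_comm]; exact h.2⟩

/-- The set of firing traces: traces of firing sequences at the initial marking. -/
def firingTraces : Set N.alphabet.Trace :=
  {t | ∃ σ m, N.FiresWord N.initial σ m ∧ N.alphabet.trace σ = t}

/-- The event structure unfolding of a net system. -/
noncomputable def unfolding [Finite T] : LabeledEventStructure.{v} T where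
  Event := {t : N.alphabet.Trace // t ∈ N.firingTraces ∧ N.alphabet.IsPrime t}
  le e e' := N.alphabet.Prefix e.1 e'.1
  conflict e e' :=
    ¬ ∃ t ∈ N.firingTraces, N.alphabet.Prefix e.1 t ∧ N.alphabet.Prefix e'.1 t
  label e := e.2.2.choose
  le_refl e := N.alphabet.prefix_refl e.1
  le_trans _ _ _ h h' := N.alphabet.prefix_trans h h'
  le_antisymm _ _ h h' := Subtype.ext (N.alphabet.prefix_antisymm h h')
  conflict_irrefl e h :=
    h ⟨e.1, e.2.1, N.alphabet.prefix_refl e.1, N.alphabet.prefix_refl e.1⟩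
  conflict_symm _ _ h := fun ⟨t, ht, h₁, h₂⟩ => h ⟨t, ht, h₂, h₁⟩
  finite_below e :=
    Set.Finite.preimage (f := Subtype.val) (s := {s | N.alphabet.Prefix s e.1})
      Subtype.val_injective.injOn (N.alphabet.finite_prefix e.1)
  conflict_of_le _ _ _ h hle := fun ⟨t, ht, h₁, h₂⟩ =>
    h ⟨t, ht, h₁, N.alphabet.prefix_trans hle h₂⟩

end NetSystem

/-! ### Directed labeled square complexes, coverings, universal covers -/

/-- A 2-dimensional cube complex with an admissible orientation and a coloring of the edges.
Edges may be loops and may be parallel. `IsSquare e f e' f'` says that there is a square with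
opposite edges `e`, `e'` and `f`, `f'` whose boundary consists of the directed paths `e f'`
and `f e'` from its source to its sink; the two ways to list the boundary of one square are
exchanged by `square_swap`. A square is determined by its boundary. -/
structure DirectedSquareComplex (Λ : Type w) where
  Vertex : Type u
  Edge : Type v
  source : Edge → Vertex
  target : Edge → Vertex
  label : Edge → Λ
  IsSquare : Edge → Edge → Edge → Edge → Prop
  square_source : ∀ e f e' f', IsSquare e f e' f' → source e = source f
  square_side : ∀ e f e' f', IsSquare e f e' f' → target e = source f'
  square_sink : ∀ e f e' f', IsSquare e f e' f' → target e' = target f'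
  square_swap : ∀ e f e' f', IsSquare e f e' f' → IsSquare f e f' e'

namespace DirectedSquareComplex

variable {Λ : Type w}

section
variable (X : DirectedSquareComplex.{u, v} Λ)

/-- A step of an edge path: an edge with a direction of traversal (`true` is forward). -/
def stepSource (s : X.Edge × Bool) : X.Vertex := if s.2 then X.source s.1 else X.target s.1

/-- The end of a step. -/
def stepTarget (s : X.Edge × Bool) : X.Vertex := if s.2 then X.target s.1 else X.source s.1

/-- `l` is an edge path of the 1-skeleton from `x` to `y`. -/
def IsPath : X.Vertex → List (X.Edge × Bool) → X.Vertex → Prop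
  | x, [], y => x = y
  | x, s :: l, y => X.stepSource s = x ∧ IsPath (X.stepTarget s) l y

/-- An elementary homotopy: insert a backtrack, or replace one side of a square by the
other. -/
def ElementaryHomotopy (l l' : List (X.Edge × Bool)) : Prop :=
  (∃ p q s, l = p ++ q ∧ l' = p ++ s :: (s.1, !s.2) :: q) ∨
  (∃ p q e f e' f', X.IsSquare e f e' f' ∧
    l = p ++ (e, true) :: (f', true) :: q ∧ l' = p ++ (f, true) :: (e', true) :: q)

/-- Homotopy of edge paths from `x` to `y`. -/
def Homotopic (x y : X.Vertex) : List (X.Edge × Bool) → List (X.Edge × Bool) → Prop :=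
  Relation.EqvGen fun l l' => X.IsPath x l y ∧ X.IsPath x l' y ∧ X.ElementaryHomotopy l l'

/-- The complex is connected and every closed edge path is null-homotopic. -/
def SimplyConnected : Prop :=
  Nonempty X.Vertex ∧ (∀ x y, ∃ l, X.IsPath x l y) ∧
    ∀ x l, X.IsPath x l x → X.Homotopic x x l []

/-- The order `≺_o` on vertices: there is a directed path from `x` to `y`. -/
def DirReach : X.Vertex → X.Vertex → Prop :=
  Relation.ReflTransGen fun x y => ∃ e, X.source e = x ∧ X.target e = y

/-- The principal filter of a vertex. -/
def filter (x : X.Vertex) : Type u := {y : X.Vertex // X.DirReach x y}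

end

/-- Maps of complexes: cubes go to cubes of the same dimension, and inclusions of cubes,
directions and colors of edges are preserved. -/
structure Hom (Y : DirectedSquareComplex.{u, v} Λ) (X : DirectedSquareComplex.{u₂, v₂} Λ) where
  onVertex : Y.Vertex → X.Vertex
  onEdge : Y.Edge → X.Edge
  source_onEdge : ∀ e, X.source (onEdge e) = onVertex (Y.source e)
  target_onEdge : ∀ e, X.target (onEdge e) = onVertex (Y.target e)
  label_onEdge : ∀ e, X.label (onEdge e) = Y.label e
  square_onEdge : ∀ e f e' f', Y.IsSquare e f e' f' →
    X.IsSquare (onEdge e) (onEdge f) (onEdge e') (onEdge f')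

/-- A covering map: a surjection that induces a bijection from the star of every vertex `y`
to the star of its image, that is, a bijection of the outgoing edges, of the incoming edges,
and of the squares having a corner at the vertex (which is their source, their sink, or one
of the two other corners, which are exchanged by `square_swap`). For squares, injectivity
follows from the bijections on edges, so only the existence of lifts is listed. -/
structure Hom.IsCovering {Y : DirectedSquareComplex.{u, v} Λ}
    {X : DirectedSquareComplex.{u₂, v₂} Λ} (φ : Hom Y X) : Prop where
  surjective : Function.Surjective φ.onVertex
  outgoing : ∀ y, Set.BijOn φ.onEdge {e | Y.source e = y} {e | X.source e = φ.onVertex y}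
  incoming : ∀ y, Set.BijOn φ.onEdge {e | Y.target e = y} {e | X.target e = φ.onVertex y}
  square_at_source : ∀ y e f e' f', X.IsSquare e f e' f' → X.source e = φ.onVertex y →
    ∃ d g d' g', Y.IsSquare d g d' g' ∧ Y.source d = y ∧
      φ.onEdge d = e ∧ φ.onEdge g = f ∧ φ.onEdge d' = e' ∧ φ.onEdge g' = f'
  square_at_side : ∀ y e f e' f', X.IsSquare e f e' f' → X.target e = φ.onVertex y →
    ∃ d g d' g', Y.IsSquare d g d' g' ∧ Y.target d = y ∧
      φ.onEdge d = e ∧ φ.onEdge g = f ∧ φ.onEdge d' = e' ∧ φ.onEdge g' = f'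
  square_at_sink : ∀ y e f e' f', X.IsSquare e f e' f' → X.target e' = φ.onVertex y →
    ∃ d g d' g', Y.IsSquare d g d' g' ∧ Y.target d' = y ∧
      φ.onEdge d = e ∧ φ.onEdge g = f ∧ φ.onEdge d' = e' ∧ φ.onEdge g' = f'

/-- A universal cover: a simply connected covering space. -/
def Hom.IsUniversalCover {Y : DirectedSquareComplex.{u, v} Λ}
    {X : DirectedSquareComplex.{u₂, v₂} Λ} (φ : Hom Y X) : Prop :=
  φ.IsCovering ∧ Y.SimplyConnected

end DirectedSquareComplex

/-- The domain of the labeled event structure `E` is the principal filter of `y` in `Y`: there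
is a bijection `θ` from the configurations of `E` to the filter that is an isomorphism both of
the ordered sets and of the directed graphs with labeled edges. -/
def LabeledEventStructure.HasDomain {Λ : Type w} (E : LabeledEventStructure.{x} Λ)
    (Y : DirectedSquareComplex.{u, v} Λ) (y : Y.Vertex) : Prop :=
  ∃ θ : E.Config ≃ Y.filter y,
    (∀ c c', c.carrier ⊆ c'.carrier ↔ Y.DirReach (θ c).1 (θ c').1) ∧
    (∀ c a c', E.HasseEdge c a c' ↔
      ∃ ε, Y.source ε = (θ c).1 ∧ Y.target ε = (θ c').1 ∧ Y.label ε = a)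

/-! ### The complex of a net system -/

namespace NetSystem

variable {S : Type u} {T : Type v} (N : NetSystem S T)

/-- The vertices of the marking graph: the connected component of the initial marking in the
support of the graph of all markings. -/
def Marking : Type u :=
  {m : Set S // Relation.EqvGen (fun m m' => ∃ a, N.Fires m a m') N.initial m}

/-- The initial marking as a vertex of the marking graph. -/
def initialMarking : N.Marking := ⟨N.initial, Relation.EqvGen.refl _⟩

/-- An edge of the directed marking graph: an arc `m --a--> m'`. -/
structure Arc where
  source : N.Marking
  action : T
  target : N.Marking
  fires : N.Fires source.1 action target.1

/-- The directed labeled complex `X_N`: its 1-skeleton is the directed marking graph, and its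
squares are spanned by `m --a--> m₁ --b--> m'` and `m --b--> m₂ --a--> m'` with `a`, `b`
independent. -/
def complex : DirectedSquareComplex T where
  Vertex := N.Marking
  Edge := N.Arc
  source := Arc.source
  target := Arc.target
  label := Arc.action
  IsSquare e f e' f' :=
    N.alphabet.indep e.action f.action ∧ e'.action = e.action ∧ f'.action = f.action ∧
      e.source = f.source ∧ e.target = f'.source ∧ f.target = e'.source ∧ e'.target = f'.target
  square_source := fun _ _ _ _ h => h.2.2.2.1
  square_side := fun _ _ _ _ h => h.2.2.2.2.1
  square_sink := fun _ _ _ _ h => h.2.2.2.2.2.2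
  square_swap := fun _ _ _ _ ⟨h₁, h₂, h₃, h₄, h₅, h₆, h₇⟩ =>
    ⟨N.alphabet.symm _ _ h₁, h₃, h₂, h₄.symm, h₆, h₅, h₇.symm⟩

end NetSystem

/-! Both domains are copies of one graph: the firing traces of the net, with an edge labeled `a`
from `t` to `t⟨a⟩`.

For the unfolding, Levi's lemma shows that a firing trace is determined by its prime prefixes, and
that appending a letter to it adds exactly one prime prefix; conversely, a prime firing trace that
can be added to the prime prefixes of `t` differs from a prefix of `t` by its last letter, which is
independent of the rest of `t`, so that it can fire after `t`.

For the universal cover, projecting words to pairs of dependent letters embeds the trace monoid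
into a product of free groups. Independent letters commute there, so the product of the labels
along an edge path is a homotopy invariant, and in a simply connected complex two directed paths
with the same ends have the same trace. Squares of the marking complex lift, so conversely words
with the same trace lead from a given vertex to the same vertex.

Finally, an event structure can be read off its domain: the configurations `↓e` are those with
exactly one lower neighbor. Every Hasse edge changes the cardinality of a configuration by one, so
the geodesics from `∅` are the directed paths, and their words are the words of a single trace. -/

/-! ### Labeled walks -/

/-- The relation "`σ` is the word of labels of a walk from `x` to `y`" in the graph whose edges
labeled `a` are the pairs related by `R · a ·`. -/
def LabeledWalk {V : Type u} {Λ : Type v} (R : V → Λ → V → Prop) : V → List Λ → V → Prop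
  | x, [], y => x = y
  | x, a :: σ, y => ∃ z, R x a z ∧ LabeledWalk R z σ y

namespace LabeledWalk

variable {V : Type u} {W : Type w} {Λ : Type v} {R : V → Λ → V → Prop} {Q : W → Λ → W → Prop}
  {x y : V} {σ τ : List Λ}

theorem singleton_iff {a : Λ} : LabeledWalk R x [a] y ↔ R x a y := by
  simp [LabeledWalk]

theorem append_iff :
    LabeledWalk R x (σ ++ τ) y ↔ ∃ z, LabeledWalk R x σ z ∧ LabeledWalk R z τ y := by
  induction σ generalizing x with
  | nil => simp [LabeledWalk]
  | cons a σ ih =>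
    simp only [List.cons_append, LabeledWalk, ih]
    tauto

theorem map (f : V → W) (hf : ∀ x a y, R x a y → Q (f x) a (f y)) (h : LabeledWalk R x σ y) :
    LabeledWalk Q (f x) σ (f y) := by
  induction σ generalizing x with
  | nil => exact congrArg f h
  | cons a σ ih =>
    obtain ⟨z, hxz, hzy⟩ := h
    exact ⟨f z, hf x a z hxz, ih hzy⟩

theorem map_equiv_iff (θ : V ≃ W) (hθ : ∀ x a y, R x a y ↔ Q (θ x) a (θ y)) :
    LabeledWalk R x σ y ↔ LabeledWalk Q (θ x) σ (θ y) := by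
  refine ⟨map θ fun x a y => (hθ x a y).1, fun h => ?_⟩
  have hsymm : ∀ x a y, Q x a y → R (θ.symm x) a (θ.symm y) := fun x a y hxy => by
    simpa [hθ] using hxy
  simpa using h.map θ.symm hsymm

theorem exists_iff_reflTransGen :
    (∃ σ, LabeledWalk R x σ y) ↔ Relation.ReflTransGen (fun x y => ∃ a, R x a y) x y := by
  constructor
  · rintro ⟨σ, h⟩
    induction σ generalizing x with
    | nil => exact h ▸ .refl
    | cons a σ ih =>
      obtain ⟨z, hxz, hzy⟩ := h
      exact .head ⟨a, hxz⟩ (ih hzy)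
  · intro h
    induction h with
    | refl => exact ⟨[], rfl⟩
    | tail _ hyz ih =>
      obtain ⟨σ, hσ⟩ := ih
      obtain ⟨a, ha⟩ := hyz
      exact ⟨σ ++ [a], append_iff.2 ⟨_, hσ, singleton_iff.2 ha⟩⟩

theorem subtype_iff {P : V → Prop} (hP : ∀ x a y, P x → R x a y → P y) {x y : Subtype P} :
    LabeledWalk (fun x a y => R x.1 a y.1) x σ y ↔ LabeledWalk R x.1 σ y.1 := by
  refine ⟨map Subtype.val fun _ _ _ => id, fun h => ?_⟩
  induction σ generalizing x with
  | nil => exact Subtype.ext h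
  | cons a σ ih =>
    obtain ⟨z, hxz, hzy⟩ := h
    exact ⟨⟨z, hP _ _ _ x.2 hxz⟩, hxz, ih hzy⟩

theorem unique (hR : ∀ x a y z, R x a y → R x a z → y = z) {z : V}
    (hy : LabeledWalk R x σ y) (hz : LabeledWalk R x σ z) : y = z := by
  induction σ generalizing x with
  | nil => exact hy.symm.trans hz
  | cons a σ ih =>
    obtain ⟨y', hxy', hy⟩ := hy
    obtain ⟨z', hxz', hz⟩ := hz
    obtain rfl := hR _ _ _ _ hxy' hxz'
    exact ih hy hz

theorem of_trace_eq {M : TraceAlphabet Λ}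
    (hR : ∀ x y a b, M.indep a b → LabeledWalk R x [a, b] y → LabeledWalk R x [b, a] y)
    (hστ : M.trace σ = M.trace τ) (h : LabeledWalk R x σ y) : LabeledWalk R x τ y := by
  rw [M.trace_eq_iff] at hστ
  induction hστ with
  | refl => exact h
  | tail _ hswap ih =>
    obtain ⟨α, β, a, b, hab, rfl, rfl⟩ := hswap
    obtain ⟨z, hα, hz⟩ := append_iff.1 ih
    obtain ⟨w, hw, hβ⟩ := (append_iff (σ := [a, b])).1 hz
    exact append_iff.2 ⟨z, hα, (append_iff (σ := [b, a])).2 ⟨w, hR z w a b hab hw, hβ⟩⟩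

end LabeledWalk

/-! ### The trace monoid -/

theorem freeMonoid_lift_freeGroup_of_injective {A : Type v} :
    Function.Injective (FreeMonoid.lift (FreeGroup.of : A → FreeGroup A)) := by
  classical
  have hmk : ∀ w : FreeMonoid A,
      FreeMonoid.lift FreeGroup.of w = FreeGroup.mk (w.toList.map fun x => (x, true)) := by
    intro w
    induction w using FreeMonoid.inductionOn' with
    | one => rfl
    | of_mul x w ih =>
      rw [map_mul, ih, FreeMonoid.lift_eval_of]
      rfl
  have hreduced : ∀ w : FreeMonoid A,
      FreeGroup.IsReduced (w.toList.map fun x => (x, true)) := fun w =>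
    List.Pairwise.isChain (List.pairwise_map.2 (List.pairwise_of_forall fun _ _ _ => rfl))
  intro w w' h
  have hword := congrArg FreeGroup.toWord h
  rw [hmk, hmk, FreeGroup.toWord_mk, FreeGroup.toWord_mk, (hreduced w).reduce_eq,
    (hreduced w').reduce_eq] at hword
  exact List.map_injective_iff.2 (fun x y hxy => (Prod.mk.inj hxy).1) hword

namespace TraceAlphabet

variable {A : Type v} (M : TraceAlphabet A)

theorem append_left {σ τ : List A} (h : Relation.ReflTransGen M.Swap σ τ) (ρ : List A) :
    Relation.ReflTransGen M.Swap (ρ ++ σ) (ρ ++ τ) := by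
  induction h with
  | refl => exact .refl
  | tail _ h ih =>
    obtain ⟨α, β, a, b, hab, rfl, rfl⟩ := h
    exact ih.tail ⟨ρ ++ α, β, a, b, hab, by simp, by simp⟩

/-- Concatenation of traces: the free partially commutative monoid of Cartier and Foata. -/
instance : Monoid M.Trace where
  mul := Quotient.map₂ (· ++ ·) fun _ σ' hσ τ _ hτ =>
    (M.append_right hσ τ).trans (M.append_left hτ σ')
  one := M.trace []
  mul_assoc := by
    rintro ⟨ρ⟩ ⟨σ⟩ ⟨τ⟩
    exact congrArg M.trace (List.append_assoc ρ σ τ)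
  one_mul := by
    rintro ⟨σ⟩
    rfl
  mul_one := by
    rintro ⟨σ⟩
    exact congrArg M.trace (List.append_nil σ)

theorem trace_nil : M.trace [] = 1 := rfl

theorem trace_append (σ τ : List A) : M.trace (σ ++ τ) = M.trace σ * M.trace τ := rfl

theorem trace_cons (a : A) (σ : List A) : M.trace (a :: σ) = M.trace [a] * M.trace σ := rfl

theorem trace_eq_prod (σ : List A) : M.trace σ = (σ.map fun a => M.trace [a]).prod := by
  induction σ with
  | nil => rfl
  | cons a σ ih => rw [trace_cons, ih, List.map_cons, List.prod_cons]

variable {M} {a b : A} {σ τ ρ : List A} {s t : M.Trace}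

theorem prefix_iff_dvd : M.Prefix s t ↔ s ∣ t := by
  obtain ⟨σ, rfl⟩ := M.exists_trace s
  obtain ⟨τ, rfl⟩ := M.exists_trace t
  rw [M.prefix_iff]
  constructor
  · rintro ⟨ρ, h⟩
    exact ⟨M.trace ρ, h.symm⟩
  · rintro ⟨r, h⟩
    obtain ⟨ρ, rfl⟩ := M.exists_trace r
    exact ⟨ρ, h.symm⟩

theorem dvd_antisymm (hst : s ∣ t) (hts : t ∣ s) : s = t :=
  M.prefix_antisymm (prefix_iff_dvd.2 hst) (prefix_iff_dvd.2 hts)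

theorem commute_trace_singleton (h : M.indep a b) : Commute (M.trace [a]) (M.trace [b]) :=
  M.trace_eq_iff.2 (.single ⟨[], [], a, b, h, rfl, rfl⟩)

theorem commute_trace (h : ∀ x ∈ ρ, M.indep a x) : Commute (M.trace [a]) (M.trace ρ) := by
  induction ρ with
  | nil => exact Commute.one_right _
  | cons x ρ ih =>
    rw [List.forall_mem_cons] at h
    exact (commute_trace_singleton h.1).mul_right (ih h.2)

theorem perm_of_trace_eq (h : M.trace σ = M.trace τ) : σ.Perm τ := by
  rw [M.trace_eq_iff] at h
  induction h with
  | refl => rfl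
  | tail _ h ih =>
    obtain ⟨α, β, a, b, -, rfl, rfl⟩ := h
    exact ih.trans ((List.Perm.swap b a β).append_left α)

section lift

variable {G : Type w} [Monoid G]

theorem list_prod_map_eq_of_trace_eq {f : A → G}
    (hf : ∀ a b, M.indep a b → Commute (f a) (f b)) (h : M.trace σ = M.trace τ) :
    (σ.map f).prod = (τ.map f).prod := by
  rw [M.trace_eq_iff] at h
  induction h with
  | refl => rfl
  | tail _ h ih =>
    obtain ⟨α, β, a, b, hab, rfl, rfl⟩ := h
    simp only [ih, List.map_append, List.map_cons, List.prod_append, List.prod_cons,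
      ← mul_assoc (f _) (f _), (hf a b hab).eq]

variable (M) in
/-- The universal property of the trace monoid: a map from the letters to a monoid under which
independent letters commute extends to a homomorphism. -/
def lift (f : A → G) (hf : ∀ a b, M.indep a b → Commute (f a) (f b)) : M.Trace →* G where
  toFun := Quotient.lift (fun σ => (σ.map f).prod) fun _ _ h =>
    list_prod_map_eq_of_trace_eq hf (M.trace_eq_iff.2 h)
  map_one' := rfl
  map_mul' := by
    rintro ⟨σ⟩ ⟨τ⟩
    exact (congrArg List.prod List.map_append).trans List.prod_append

theorem lift_trace (f : A → G) (hf : ∀ a b, M.indep a b → Commute (f a) (f b)) (σ : List A) :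
    M.lift f hf (M.trace σ) = (σ.map f).prod := rfl

end lift

/-! ### Separation of traces by projections to pairs of dependent letters -/

open Classical in
/-- The projection of traces that erases all letters except two dependent ones, between which no
commutation is left. -/
noncomputable def proj (hab : ¬ M.indep a b) : M.Trace →* FreeMonoid A :=
  M.lift (fun x => if x = a ∨ x = b then FreeMonoid.of x else 1) fun x y hxy => by
    have hx := M.irrefl x
    have hyx := M.symm x y hxy
    grind [Commute.one_left, Commute.one_right]

open Classical in
theorem toList_proj_trace (hab : ¬ M.indep a b) (σ : List A) :
    (proj hab (M.trace σ)).toList = σ.filter fun x => x = a ∨ x = b := by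
  induction σ with
  | nil => rfl
  | cons x σ ih =>
    rw [trace_cons, map_mul, FreeMonoid.toList_mul, ih, List.filter_cons, proj, lift_trace]
    by_cases hx : x = a ∨ x = b <;> simp [hx]

theorem exists_append_cons_of_head_filter [DecidableEq A]
    (h : ∀ b, ¬ M.indep a b → (τ.filter fun x => x = a ∨ x = b).head? = some a) :
    ∃ u v, τ = u ++ a :: v ∧ ∀ x ∈ u, M.indep a x := by
  have ha : a ∈ τ := (List.mem_filter.1 (List.mem_of_mem_head? (h a (M.irrefl a)))).1
  obtain ⟨u, v, rfl, hau⟩ := List.eq_append_cons_of_mem ha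
  refine ⟨u, v, rfl, fun x hx => ?_⟩
  by_contra hax
  have hne : (u.filter fun y => y = a ∨ y = x) ≠ [] :=
    List.ne_nil_of_mem (List.mem_filter.2 ⟨hx, by simp⟩)
  have hhead := h x hax
  rw [List.filter_append, List.head?_append_of_ne_nil _ hne] at hhead
  exact hau (List.mem_filter.1 (List.mem_of_mem_head? hhead)).1

theorem trace_append_cons_of_indep {u v : List A} (h : ∀ x ∈ u, M.indep a x) :
    M.trace (u ++ a :: v) = M.trace [a] * M.trace (u ++ v) := by
  rw [trace_append, trace_cons, trace_append, ← mul_assoc, ← mul_assoc, (commute_trace h).eq]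

theorem trace_singleton_dvd_iff :
    M.trace [a] ∣ M.trace τ ↔ ∃ u v, τ = u ++ a :: v ∧ ∀ x ∈ u, M.indep a x := by
  classical
  constructor
  · rintro ⟨s, hs⟩
    refine exists_append_cons_of_head_filter fun b hab => ?_
    rw [← toList_proj_trace hab τ, hs, map_mul, FreeMonoid.toList_mul, toList_proj_trace hab [a]]
    simp
  · rintro ⟨u, v, rfl, hu⟩
    exact ⟨_, trace_append_cons_of_indep hu⟩

theorem eq_of_forall_proj_eq (h : ∀ a b (hab : ¬ M.indep a b), proj hab s = proj hab t) :
    s = t := by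
  classical
  obtain ⟨σ, rfl⟩ := M.exists_trace s
  obtain ⟨τ, rfl⟩ := M.exists_trace t
  induction σ generalizing τ with
  | nil =>
    have hτ : ∀ x, x ∉ τ := fun x hx => by
      have hnil := congrArg FreeMonoid.toList (h x x (M.irrefl x))
      rw [toList_proj_trace, toList_proj_trace, eq_comm, List.filter_nil,
        List.filter_eq_nil_iff] at hnil
      exact hnil x hx (by simp)
    rw [List.eq_nil_iff_forall_not_mem.2 hτ]
  | cons a σ ih =>
    obtain ⟨u, v, rfl, hu⟩ : ∃ u v, τ = u ++ a :: v ∧ ∀ x ∈ u, M.indep a x :=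
      exists_append_cons_of_head_filter fun b hab => by
        rw [← toList_proj_trace hab τ, ← h a b hab, toList_proj_trace]
        simp
    rw [trace_append_cons_of_indep hu, trace_cons] at h ⊢
    rw [ih (u ++ v) fun b c hbc => mul_left_cancel (by simpa only [map_mul] using h b c hbc)]

instance : IsCancelMul M.Trace where
  mul_left_cancel r s t h := eq_of_forall_proj_eq fun a b hab =>
    mul_left_cancel (by simpa only [map_mul] using congrArg (proj hab) h)
  mul_right_cancel r s t h := eq_of_forall_proj_eq fun a b hab =>
    mul_right_cancel (by simpa only [map_mul] using congrArg (proj hab) h)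

variable (M) in
/-- A homomorphism from the trace monoid to a group, by which a holonomy in a group remembers
traces: the projections to all pairs of dependent letters, read in free groups. -/
noncomputable def toGroup : M.Trace →* ({p : A × A // ¬ M.indep p.1 p.2} → FreeGroup A) :=
  MonoidHom.pi fun p => (FreeMonoid.lift FreeGroup.of).comp (proj p.2)

theorem toGroup_injective : Function.Injective M.toGroup := fun _ _ h =>
  eq_of_forall_proj_eq fun a b hab =>
    freeMonoid_lift_freeGroup_of_injective (congrFun h ⟨(a, b), hab⟩)

/-! ### Prefixes and prime traces -/

theorem mul_trace_singleton_induction {motive : M.Trace → Prop} (one : motive 1)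
    (mul : ∀ s a, motive s → motive (s * M.trace [a])) (t : M.Trace) : motive t := by
  obtain ⟨τ, rfl⟩ := M.exists_trace t
  induction τ using List.reverseRecOn with
  | nil => exact one
  | append_singleton τ a ih => exact mul _ a ih

theorem mul_trace_singleton_ne_one : s * M.trace [a] ≠ 1 := by
  obtain ⟨σ, rfl⟩ := M.exists_trace s
  exact fun h => by simpa using (perm_of_trace_eq (σ := σ ++ [a]) (τ := []) h).length_eq

theorem mem_of_trace_singleton_dvd (h : M.trace [a] ∣ M.trace τ) : a ∈ τ := by
  obtain ⟨u, v, rfl, -⟩ := trace_singleton_dvd_iff.1 h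
  simp

theorem trace_singleton_dvd_mul (h : M.trace [a] ∣ M.trace σ * t) :
    M.trace [a] ∣ M.trace σ ∨ (∀ x ∈ σ, M.indep a x) ∧ M.trace [a] ∣ t := by
  obtain ⟨τ, rfl⟩ := M.exists_trace t
  obtain ⟨u, v, huv, hu⟩ := trace_singleton_dvd_iff.1 h
  rcases List.append_eq_append_iff.1 huv with ⟨w, rfl, rfl⟩ | ⟨_ | ⟨x, w⟩, rfl, hw⟩
  · rw [List.forall_mem_append] at hu
    exact .inr ⟨hu.1, trace_singleton_dvd_iff.2 ⟨w, v, rfl, hu.2⟩⟩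
  · refine .inr ⟨by simpa using hu, trace_singleton_dvd_iff.2 ⟨[], v, by simpa using hw.symm, ?_⟩⟩
    simp
  · obtain ⟨rfl, -⟩ := List.cons.inj hw
    exact .inl (trace_singleton_dvd_iff.2 ⟨u, w, rfl, hu⟩)

/-- Levi's lemma for a factorization with a single letter on the right. -/
theorem dvd_or_exists_of_mul_eq_mul_singleton (h : s * M.trace ρ = t * M.trace [a]) :
    s ∣ t ∨ (∀ x ∈ ρ, M.indep a x) ∧ ∃ r, s = r * M.trace [a] ∧ r * M.trace ρ = t := by
  obtain ⟨σ, rfl⟩ := M.exists_trace s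
  induction σ generalizing t with
  | nil => exact .inl (one_dvd t)
  | cons x σ ih =>
    obtain ⟨τ, rfl⟩ := M.exists_trace t
    rw [trace_cons] at h ⊢
    rw [mul_assoc] at h
    rcases trace_singleton_dvd_mul (Dvd.intro _ h) with ⟨r, hr⟩ | ⟨hτ, hxa⟩
    · rw [hr] at h ⊢
      rw [mul_assoc] at h
      rcases ih (mul_left_cancel h) with hdvd | ⟨hρ, q, hq, rfl⟩
      · exact .inl (mul_dvd_mul_left _ hdvd)
      · exact .inr ⟨hρ, M.trace [x] * q, by rw [hq, mul_assoc], mul_assoc _ _ _⟩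
    · obtain rfl := List.mem_singleton.1 (mem_of_trace_singleton_dvd hxa)
      rw [← (commute_trace hτ).eq] at h
      have hστ : M.trace (σ ++ ρ) = M.trace τ := mul_left_cancel h
      have hσρ : ∀ y ∈ σ ++ ρ, M.indep x y := fun y hy => hτ y ((perm_of_trace_eq hστ).subset hy)
      rw [List.forall_mem_append] at hσρ
      exact .inr ⟨hσρ.2, M.trace σ, commute_trace hσρ.1, hστ⟩

theorem exists_of_mul_singleton_eq_mul_singleton (hne : a ≠ b)
    (h : s * M.trace [a] = t * M.trace [b]) :
    M.indep a b ∧ ∃ r, s = r * M.trace [b] ∧ t = r * M.trace [a] := by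
  rcases dvd_or_exists_of_mul_eq_mul_singleton h with ⟨r, rfl⟩ | ⟨hab, r, hs, ht⟩
  · rw [mul_assoc] at h
    obtain ⟨κ, rfl⟩ := M.exists_trace r
    have hb : b ∈ [a] := (perm_of_trace_eq (τ := κ ++ [b]) (mul_left_cancel h)).mem_iff.2 (by simp)
    exact absurd (List.mem_singleton.1 hb).symm hne
  · exact ⟨M.symm _ _ (hab a (List.mem_singleton_self a)), r, hs, ht.symm⟩

/-- The prime traces of `TraceAlphabet.IsPrime`, with their last letter made explicit. -/
def IsPrimeEndingIn (p : M.Trace) (a : A) : Prop := ∀ σ, M.trace σ = p → σ.getLast? = some a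

theorem isPrimeEndingIn_mul_iff :
    IsPrimeEndingIn (s * M.trace [a]) a ↔ ∀ t b, s * M.trace [a] = t * M.trace [b] → b = a := by
  constructor
  · intro h t b hb
    obtain ⟨τ, rfl⟩ := M.exists_trace t
    simpa using h (τ ++ [b]) hb.symm
  · intro h σ hσ
    rcases List.eq_nil_or_concat' σ with rfl | ⟨τ, b, rfl⟩
    · exact absurd hσ.symm mul_trace_singleton_ne_one
    · rw [List.getLast?_concat, h (M.trace τ) b hσ.symm]

theorem exists_isPrimeEndingIn (s : M.Trace) (a : A) :
    ∃ p ρ, s = p * M.trace ρ ∧ (∀ x ∈ ρ, M.indep a x) ∧ IsPrimeEndingIn (p * M.trace [a]) a := by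
  obtain ⟨σ, rfl⟩ := M.exists_trace s
  induction hn : σ.length using Nat.strong_induction_on generalizing σ with
  | h n ih =>
    by_cases hprime : IsPrimeEndingIn (M.trace σ * M.trace [a]) a
    · exact ⟨M.trace σ, [], (mul_one _).symm, by simp, hprime⟩
    · simp only [isPrimeEndingIn_mul_iff, not_forall] at hprime
      obtain ⟨t, b, heq, hba⟩ := hprime
      obtain ⟨hab, r, hσ, -⟩ := exists_of_mul_singleton_eq_mul_singleton (Ne.symm hba) heq
      obtain ⟨τ, rfl⟩ := M.exists_trace r
      have hlen : τ.length < n := by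
        simpa [← hn] using (perm_of_trace_eq (τ := τ ++ [b]) hσ).length_eq.ge
      obtain ⟨p, ρ, hτ, hρ, hp⟩ := ih _ hlen τ rfl
      refine ⟨p, ρ ++ [b], by rw [hσ, hτ, mul_assoc, trace_append], ?_, hp⟩
      simpa [or_imp, forall_and] using ⟨hρ, hab⟩

namespace IsPrimeEndingIn

variable {p q : M.Trace}

theorem eq_of_eq_mul (hp : IsPrimeEndingIn p a) (h : p = s * M.trace [b]) : b = a := by
  obtain ⟨σ, rfl⟩ := M.exists_trace s
  simpa using hp (σ ++ [b]) h.symm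

theorem exists_eq_mul (hp : IsPrimeEndingIn p a) : ∃ s, p = s * M.trace [a] := by
  obtain ⟨σ, rfl⟩ := M.exists_trace p
  obtain ⟨τ, rfl⟩ := List.getLast?_eq_some_iff.1 (hp σ rfl)
  exact ⟨M.trace τ, M.trace_append τ [a]⟩

theorem not_dvd_one (hp : IsPrimeEndingIn p a) : ¬ p ∣ 1 := by
  obtain ⟨s, rfl⟩ := hp.exists_eq_mul
  exact fun h => mul_trace_singleton_ne_one (dvd_antisymm h (one_dvd _))

theorem dvd_of_dvd_mul_trace (hp : IsPrimeEndingIn p a) (ha : a ∉ ρ) (h : p ∣ t * M.trace ρ) :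
    p ∣ t := by
  induction ρ using List.reverseRecOn with
  | nil => rwa [trace_nil, mul_one] at h
  | append_singleton ρ b ih =>
    rw [List.mem_append, List.mem_singleton, not_or] at ha
    rw [trace_append, ← mul_assoc] at h
    obtain ⟨r, hr⟩ := h
    obtain ⟨κ, rfl⟩ := M.exists_trace r
    rcases dvd_or_exists_of_mul_eq_mul_singleton hr.symm with hdvd | ⟨-, q, hq, -⟩
    · exact ih ha.1 hdvd
    · exact absurd (hp.eq_of_eq_mul hq).symm ha.2

theorem eq_or_dvd_of_dvd (hp : IsPrimeEndingIn (p * M.trace [a]) a) (h : s ∣ p * M.trace [a]) :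
    s = p * M.trace [a] ∨ s ∣ p := by
  obtain ⟨r, hr⟩ := h
  obtain ⟨ρ, rfl⟩ := M.exists_trace r
  rcases List.eq_nil_or_concat' ρ with rfl | ⟨ρ, b, rfl⟩
  · exact .inl (by rw [hr, trace_nil, mul_one])
  · obtain rfl : b = a :=
      hp.eq_of_eq_mul (hr.trans (mul_assoc s (M.trace ρ) (M.trace [b])).symm)
    rcases dvd_or_exists_of_mul_eq_mul_singleton hr.symm with hdvd | ⟨hind, -⟩
    · exact .inr hdvd
    · exact absurd (hind b (by simp)) (M.irrefl b)

theorem dvd_or_dvd_of_common_multiple (hp : IsPrimeEndingIn p a) (hq : IsPrimeEndingIn q b)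
    (hab : ¬ M.indep a b) (hpt : p ∣ t) (hqt : q ∣ t) : p ∣ q ∨ q ∣ p := by
  have hnew : ∀ {p q : M.Trace} {a b : A} (t : M.Trace) (c : A), IsPrimeEndingIn p a →
      IsPrimeEndingIn q b → ¬ M.indep b a → p ∣ t * M.trace [c] → q ∣ t * M.trace [c] →
      ¬ q ∣ t → p ∣ q := by
    intro p q a b t c hp hq hba hpt hqt hqt'
    obtain ⟨r, hr⟩ := hqt
    obtain ⟨κ, rfl⟩ := M.exists_trace r
    rcases dvd_or_exists_of_mul_eq_mul_singleton hr.symm with hdvd | ⟨hind, r, hq', -⟩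
    · exact absurd hdvd hqt'
    · obtain rfl := hq.eq_of_eq_mul hq'
      exact hp.dvd_of_dvd_mul_trace (fun ha => hba (hind a ha)) (hr ▸ hpt)
  induction t using mul_trace_singleton_induction with
  | one => exact .inl (hpt.trans (one_dvd q))
  | mul t c ih =>
    by_cases hpt' : p ∣ t
    · by_cases hqt' : q ∣ t
      · exact ih hpt' hqt'
      · exact .inl (hnew t c hp hq (fun h => hab (M.symm _ _ h)) hpt hqt hqt')
    · exact .inr (hnew t c hq hp hab hqt hpt hpt')

end IsPrimeEndingIn

variable {p q : M.Trace}

theorem not_mul_singleton_dvd_mul_trace (hρ : ∀ x ∈ ρ, M.indep a x) :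
    ¬ p * M.trace [a] ∣ p * M.trace ρ := by
  rintro ⟨r, hr⟩
  rw [mul_assoc] at hr
  exact M.irrefl a (hρ a (mem_of_trace_singleton_dvd (Dvd.intro r (mul_left_cancel hr).symm)))

theorem mul_singleton_dvd_mul_trace_mul (hρ : ∀ x ∈ ρ, M.indep a x) :
    p * M.trace [a] ∣ p * M.trace ρ * M.trace [a] :=
  ⟨M.trace ρ, by rw [mul_assoc, mul_assoc, (commute_trace hρ).eq]⟩

theorem IsPrimeEndingIn.dvd_mul_iff (hq : IsPrimeEndingIn q b)
    (hp : IsPrimeEndingIn (p * M.trace [a]) a) (hρ : ∀ x ∈ ρ, M.indep a x) :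
    q ∣ p * M.trace ρ * M.trace [a] ↔ q = p * M.trace [a] ∨ q ∣ p * M.trace ρ := by
  constructor
  · intro h
    by_cases hab : a = b
    · subst hab
      rw [mul_assoc, ← (commute_trace hρ).eq, ← mul_assoc] at h
      exact (hp.eq_or_dvd_of_dvd
        (hq.dvd_of_dvd_mul_trace (fun ha => M.irrefl a (hρ a ha)) h)).imp_right
          (·.trans (Dvd.intro _ rfl))
    · exact .inr (hq.dvd_of_dvd_mul_trace (by simpa using Ne.symm hab) h)
  · rintro (rfl | h)
    · exact mul_singleton_dvd_mul_trace_mul hρ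
    · exact h.trans (Dvd.intro _ rfl)

theorem dvd_of_forall_isPrimeEndingIn_dvd
    (h : ∀ p a, IsPrimeEndingIn p a → p ∣ s → p ∣ t) : s ∣ t := by
  induction s using mul_trace_singleton_induction with
  | one => exact one_dvd t
  | mul s a ih =>
    obtain ⟨w, rfl⟩ := ih fun p b hp hps => h p b hp (hps.trans (Dvd.intro _ rfl))
    obtain ⟨p, ρ, rfl, hρ, hp⟩ := exists_isPrimeEndingIn s a
    obtain ⟨r, hr⟩ := h _ a hp (mul_singleton_dvd_mul_trace_mul hρ)
    rw [mul_assoc, mul_assoc] at hr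
    rcases trace_singleton_dvd_mul (Dvd.intro _ (mul_left_cancel hr).symm) with hdvd | ⟨-, hdvd⟩
    · exact absurd (hρ a (mem_of_trace_singleton_dvd hdvd)) (M.irrefl a)
    · exact mul_dvd_mul_left _ hdvd

theorem IsPrimeEndingIn.forall_indep_of_compatible (hp : IsPrimeEndingIn (p * M.trace [a]) a)
    (hnot : ¬ p * M.trace [a] ∣ p * M.trace ρ)
    (hcompat : ∀ q b, IsPrimeEndingIn q b → q ∣ p * M.trace ρ →
      ∃ t, q ∣ t ∧ p * M.trace [a] ∣ t) :
    ∀ x ∈ ρ, M.indep a x := by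
  induction ρ using List.reverseRecOn with
  | nil => simp
  | append_singleton ρ x ih =>
    rw [trace_append, ← mul_assoc] at hnot hcompat
    have hρ : ∀ y ∈ ρ, M.indep a y := ih (fun h => hnot (h.trans (Dvd.intro _ rfl)))
      fun q b hq hqs => hcompat q b hq (hqs.trans (Dvd.intro _ rfl))
    suffices hax : M.indep a x by simpa [or_imp, forall_and] using ⟨hρ, hax⟩
    by_contra hax
    obtain ⟨q, κ, hqκ, hκ, hq⟩ := exists_isPrimeEndingIn (p * M.trace ρ) x
    have hqs : q * M.trace [x] ∣ p * M.trace ρ * M.trace [x] :=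
      hqκ ▸ mul_singleton_dvd_mul_trace_mul hκ
    obtain ⟨t, hqt, hpt⟩ := hcompat _ x hq hqs
    rcases hp.dvd_or_dvd_of_common_multiple hq hax hpt hqt with hpq | hqp
    · exact hnot (hpq.trans hqs)
    · rcases hp.eq_or_dvd_of_dvd hqp with heq | hdvd
      · exact hnot (heq ▸ hqs)
      · exact not_mul_singleton_dvd_mul_trace hκ (hqκ ▸ hdvd.trans (Dvd.intro _ rfl))

end TraceAlphabet

/-! ### Event structures and their domains -/

namespace LabeledEventStructure

variable {Λ : Type v} {E : LabeledEventStructure.{u} Λ} {E' : LabeledEventStructure.{w} Λ}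
  {c c' d : E.Config} {a : Λ} {σ : List Λ} {e e' : E.Event}

namespace Config

theorem ext_carrier (h : c.carrier = c'.carrier) : c = c' := by
  cases c
  cases c'
  cases h
  rfl

theorem exists_maximal_above (c : E.Config) (he : e ∈ c.carrier) :
    ∃ m ∈ c.carrier, E.le e m ∧ ∀ e' ∈ c.carrier, E.le m e' → e' = m := by
  let _ : PartialOrder E.Event :=
    { le := E.le
      le_refl := E.le_refl
      le_trans := E.le_trans
      le_antisymm := E.le_antisymm }
  obtain ⟨m, hem, hm⟩ := c.finite.exists_le_maximal he
  exact ⟨m, hm.prop, hem, fun e' he' h => E.le_antisymm _ _ (hm.le_of_ge he' h) h⟩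

/-- The configuration obtained by removing a maximal event, used to go down along the edges of
the domain. -/
def erase (c : E.Config) (e : E.Event) (hmax : ∀ e' ∈ c.carrier, E.le e e' → e' = e) :
    E.Config where
  carrier := c.carrier \ {e}
  finite := c.finite.sdiff
  conflictFree x hx y hy := c.conflictFree x hx.1 y hy.1
  downClosed x hx y hyx :=
    ⟨c.downClosed x hx.1 y hyx, fun hye => hx.2 (hmax x hx.1 (Set.mem_singleton_iff.1 hye ▸ hyx))⟩

theorem hasseEdge_erase (he : e ∈ c.carrier) (hmax : ∀ e' ∈ c.carrier, E.le e e' → e' = e) :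
    E.HasseEdge (c.erase e hmax) (E.label e) c :=
  ⟨e, fun h => h.2 rfl, (Set.insert_sdiff_self_of_mem he).symm, rfl⟩

end Config

namespace HasseEdge

theorem subset (h : E.HasseEdge c a c') : c.carrier ⊆ c'.carrier := by
  obtain ⟨e, -, hc, -⟩ := h
  exact hc ▸ Set.subset_insert e c.carrier

theorem ncard_eq (h : E.HasseEdge c a c') : c'.carrier.ncard = c.carrier.ncard + 1 := by
  obtain ⟨e, he, hc, -⟩ := h
  rw [hc, Set.ncard_insert_of_notMem he c.finite]

end HasseEdge

theorem subset_of_labeledWalk (h : LabeledWalk E.HasseEdge c σ c') : c.carrier ⊆ c'.carrier := by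
  induction σ generalizing c with
  | nil => exact (congrArg Config.carrier h).subset
  | cons a σ ih =>
    obtain ⟨d, hcd, hd⟩ := h
    exact hcd.subset.trans (ih hd)

theorem ncard_eq_of_labeledWalk (h : LabeledWalk E.HasseEdge c σ c') :
    c'.carrier.ncard = c.carrier.ncard + σ.length := by
  induction σ generalizing c with
  | nil => simp [show c = c' from h]
  | cons a σ ih =>
    obtain ⟨d, hcd, hd⟩ := h
    rw [ih hd, hcd.ncard_eq, List.length_cons]
    ring

theorem subset_iff_exists_labeledWalk :
    c.carrier ⊆ c'.carrier ↔ ∃ σ, LabeledWalk E.HasseEdge c σ c' := by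
  refine ⟨fun h => ?_, fun ⟨σ, hσ⟩ => subset_of_labeledWalk hσ⟩
  induction hn : c'.carrier.ncard generalizing c' with
  | zero =>
    rw [Set.ncard_eq_zero c'.finite] at hn
    exact ⟨[], Config.ext_carrier (h.antisymm (hn ▸ Set.empty_subset _))⟩
  | succ n ih =>
    by_cases hcc' : c'.carrier ⊆ c.carrier
    · exact ⟨[], Config.ext_carrier (h.antisymm hcc')⟩
    · obtain ⟨x, hxc', hxc⟩ := Set.not_subset.1 hcc'
      obtain ⟨m, hm, hxm, hmax⟩ := c'.exists_maximal_above hxc'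
      have hedge := Config.hasseEdge_erase hm hmax
      have hmc : m ∉ c.carrier := fun hmc => hxc (c.downClosed m hmc x hxm)
      obtain ⟨σ, hσ⟩ := ih (c' := c'.erase m hmax)
        (fun y hy => ⟨h hy, fun hym => hmc (Set.mem_singleton_iff.1 hym ▸ hy)⟩)
        (by simpa [hn] using hedge.ncard_eq.symm)
      exact ⟨σ ++ [E.label m],
        LabeledWalk.append_iff.2 ⟨_, hσ, LabeledWalk.singleton_iff.2 hedge⟩⟩

/-! #### Geodesics -/

theorem pathWord_of_labeledWalk (h : LabeledWalk E.HasseEdge c σ c') : E.PathWord c σ c' := by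
  induction σ generalizing c with
  | nil => exact h
  | cons a σ ih =>
    obtain ⟨d, hcd, hd⟩ := h
    exact ⟨d, .inl hcd, ih hd⟩

namespace PathWord

theorem ncard_le (h : E.PathWord c σ c') : c'.carrier.ncard ≤ c.carrier.ncard + σ.length := by
  induction σ generalizing c with
  | nil => simp [show c = c' from h]
  | cons a σ ih =>
    obtain ⟨d, hcd | hcd, hd⟩ := h <;>
    · have hcard := hcd.ncard_eq
      have hle := ih hd
      rw [List.length_cons]
      omega

theorem labeledWalk_of_le_ncard (h : E.PathWord c σ c')
    (hcard : c.carrier.ncard + σ.length ≤ c'.carrier.ncard) :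
    LabeledWalk E.HasseEdge c σ c' := by
  induction σ generalizing c with
  | nil => exact h
  | cons a σ ih =>
    obtain ⟨d, hcd | hdc, hd⟩ := h
    · exact ⟨d, hcd, ih hd (by simpa [hcd.ncard_eq, add_assoc, add_comm 1] using hcard)⟩
    · have hle := hd.ncard_le
      rw [hdc.ncard_eq, List.length_cons] at hcard
      omega

end PathWord

theorem isGeodesicWord_iff :
    E.IsGeodesicWord c σ ↔ LabeledWalk E.HasseEdge E.emptyConfig σ c := by
  constructor
  · rintro ⟨hσ, hmin⟩
    obtain ⟨τ, hτ⟩ := subset_iff_exists_labeledWalk.1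
      (show E.emptyConfig.carrier ⊆ c.carrier from Set.empty_subset _)
    refine hσ.labeledWalk_of_le_ncard ?_
    rw [ncard_eq_of_labeledWalk hτ]
    exact Nat.add_le_add_left (hmin τ (pathWord_of_labeledWalk hτ)) _
  · intro h
    refine ⟨pathWord_of_labeledWalk h, fun τ hτ => ?_⟩
    have hle := hτ.ncard_le
    rw [ncard_eq_of_labeledWalk h] at hle
    exact Nat.le_of_add_le_add_left hle

/-! #### The domain determines the event structure -/

theorem below_subset_iff : (E.below e).carrier ⊆ c.carrier ↔ e ∈ c.carrier :=
  ⟨fun h => h (E.le_refl e), fun h x hx => c.downClosed e h x hx⟩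

theorem below_injective : Function.Injective E.below := fun e e' h =>
  E.le_antisymm _ _ (below_subset_iff.1 (h ▸ subset_rfl) : e ∈ (E.below e').carrier)
    (below_subset_iff.1 (h ▸ subset_rfl) : e' ∈ (E.below e).carrier)

theorem conflict_iff_not_exists_config :
    E.conflict e e' ↔ ¬ ∃ c : E.Config, e ∈ c.carrier ∧ e' ∈ c.carrier := by
  refine ⟨fun h ⟨c, he, he'⟩ => c.conflictFree e he e' he' h, fun h => ?_⟩
  by_contra hee'
  have hcross : ∀ x y, E.le x e → E.le y e' → ¬ E.conflict x y := fun x y hx hy hxy =>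
    hee' (E.conflict_symm _ _ (E.conflict_of_le _ _ _
      (E.conflict_symm _ _ (E.conflict_of_le _ _ _ hxy hy)) hx))
  refine h ⟨⟨(E.below e).carrier ∪ (E.below e').carrier, (E.below e).finite.union
    (E.below e').finite, ?_, ?_⟩, .inl (E.le_refl e), .inr (E.le_refl e')⟩
  · rintro x (hx | hx) y (hy | hy) hxy
    · exact (E.below e).conflictFree x hx y hy hxy
    · exact hcross x y hx hy hxy
    · exact hcross y x hy hx (E.conflict_symm _ _ hxy)
    · exact (E.below e').conflictFree x hx y hy hxy
  · rintro x (hx | hx) y hyx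
    · exact .inl ((E.below e).downClosed x hx y hyx)
    · exact .inr ((E.below e').downClosed x hx y hyx)

variable (E) in
/-- The configuration `↓e ∖ {e}`, the unique lower neighbor of `↓e` in the domain. -/
def strictBelow (e : E.Event) : E.Config :=
  (E.below e).erase e fun _ hle hge => E.le_antisymm _ _ hle hge

theorem hasseEdge_below_iff :
    E.HasseEdge d a (E.below e) ↔ d = E.strictBelow e ∧ E.label e = a := by
  constructor
  · rintro ⟨x, hx, hins, rfl⟩
    have hxe : E.le x e := hins.ge (Set.mem_insert x _)
    have hed : e = x ∨ e ∈ d.carrier := hins.le (E.le_refl e)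
    obtain rfl : e = x := hed.resolve_right fun he => hx (d.downClosed e he x hxe)
    refine ⟨Config.ext_carrier ?_, rfl⟩
    change d.carrier = (E.below e).carrier \ {e}
    rw [hins, Set.insert_sdiff_self_of_notMem hx]
  · rintro ⟨rfl, rfl⟩
    exact Config.hasseEdge_erase (E.le_refl e) _

theorem exists_below_eq_iff : (∃ e, E.below e = c) ↔ ∃! d, ∃ a, E.HasseEdge d a c := by
  constructor
  · rintro ⟨e, rfl⟩
    exact ⟨E.strictBelow e, ⟨E.label e, hasseEdge_below_iff.2 ⟨rfl, rfl⟩⟩,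
      fun d ⟨a, h⟩ => (hasseEdge_below_iff.1 h).1⟩
  · rintro ⟨d, ⟨a, x, hx, hins, -⟩, hunique⟩
    have hxc : x ∈ c.carrier := hins.ge (Set.mem_insert x _)
    refine ⟨x, Config.ext_carrier ((below_subset_iff.2 hxc).antisymm fun y hy => ?_)⟩
    obtain ⟨m, hm, hym, hmax⟩ := c.exists_maximal_above hy
    have herase := hunique _ ⟨_, Config.hasseEdge_erase hm hmax⟩
    have hmx : m = x ∨ m ∈ d.carrier := hins.le hm
    obtain rfl : m = x := hmx.resolve_right fun hmd => (herase ▸ hmd).2 rfl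
    exact hym

section domainIso

variable (θ : E.Config ≃ E'.Config) (hθ : ∀ c a c', E.HasseEdge c a c' ↔
  E'.HasseEdge (θ c) a (θ c'))
include hθ

theorem subset_iff_of_hasseEdge_iff :
    c.carrier ⊆ c'.carrier ↔ (θ c).carrier ⊆ (θ c').carrier := by
  rw [subset_iff_exists_labeledWalk, subset_iff_exists_labeledWalk]
  exact exists_congr fun σ => LabeledWalk.map_equiv_iff θ hθ

theorem exists_below_eq_apply_iff : (∃ e, E.below e = c) ↔ ∃ e', E'.below e' = θ c := by
  rw [exists_below_eq_iff, exists_below_eq_iff]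
  exact θ.existsUnique_congr fun {d} => exists_congr fun a => hθ d a c

theorem exists_equiv_below_eq : ∃ F : E.Event ≃ E'.Event, ∀ e, E'.below (F e) = θ (E.below e) := by
  choose F hF using fun e => (exists_below_eq_apply_iff θ hθ).1 ⟨e, rfl⟩
  refine ⟨.ofBijective F ⟨fun e e' h => ?_, fun e' => ?_⟩, hF⟩
  · exact below_injective (θ.injective (by rw [← hF, ← hF, h]))
  · obtain ⟨e, he⟩ := (exists_below_eq_apply_iff θ hθ (c := θ.symm (E'.below e'))).2
      ⟨e', (θ.apply_symm_apply _).symm⟩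
    exact ⟨e, below_injective (by rw [hF, he, θ.apply_symm_apply])⟩

theorem exists_iso_of_hasseEdge_iff :
    ∃ f : E.Iso E', ∀ e, E'.below (f.toEquiv e) = θ (E.below e) := by
  obtain ⟨F, hF⟩ := exists_equiv_below_eq θ hθ
  have hmem : ∀ e c, e ∈ c.carrier ↔ F e ∈ (θ c).carrier := fun e c => by
    rw [← below_subset_iff, ← below_subset_iff, hF, subset_iff_of_hasseEdge_iff θ hθ]
  refine ⟨⟨F, fun e e' => ?_, fun e e' => ?_, fun e => ?_⟩, hF⟩
  · have hle := hmem e (E.below e')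
    rwa [← hF] at hle
  · rw [conflict_iff_not_exists_config, conflict_iff_not_exists_config]
    refine not_congr (θ.exists_congr fun c => ?_)
    rw [hmem e c, hmem e' c]
  · have hedge := (hθ _ _ _).1 (hasseEdge_below_iff.2 ⟨rfl, rfl⟩ :
      E.HasseEdge (E.strictBelow e) (E.label e) (E.below e))
    exact (hasseEdge_below_iff.1 (hF e ▸ hedge)).2

end domainIso

end LabeledEventStructure

/-! ### Firing sequences -/

namespace NetSystem

variable {S : Type u} {T : Type v} {N : NetSystem S T} {m m₁ m₂ : Set S} {a b : T} {σ τ : List T}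

theorem not_mem_of_indep (h : N.alphabet.indep a b) (s : S) :
    ¬((s ∈ N.pre a ∨ s ∈ N.post a) ∧ (s ∈ N.pre b ∨ s ∈ N.post b)) := fun hs =>
  (Set.ext_iff.1 h.2 s).1 hs

theorem fires_iff :
    N.Fires m₁ a m₂ ↔ (∀ s ∈ N.pre a, s ∈ m₁) ∧ (∀ s ∈ N.post a, s ∈ m₁ → s ∈ N.pre a) ∧
      ∀ s, s ∈ m₂ ↔ (s ∈ m₁ ∧ s ∉ N.pre a) ∨ s ∈ N.post a := by
  refine and_congr Iff.rfl (and_congr ?_ Set.ext_iff)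
  simp only [Set.eq_empty_iff_forall_notMem, Set.mem_inter_iff, Set.mem_sdiff]
  exact forall_congr' fun s => by tauto

theorem Fires.unique (h₁ : N.Fires m a m₁) (h₂ : N.Fires m a m₂) : m₁ = m₂ :=
  h₁.2.2.trans h₂.2.2.symm

theorem Fires.exists_of_indep (hab : N.alphabet.indep a b) (h₁ : N.Fires m a m₁)
    (h₂ : N.Fires m b m₂) : ∃ m₃, N.Fires m₂ a m₃ := by
  refine ⟨(m₂ \ N.pre a) ∪ N.post a, fires_iff.2 ⟨?_, ?_, fun s => Iff.rfl⟩⟩ <;>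
  · intro s
    have hdisj := not_mem_of_indep hab s
    have hpre := (fires_iff.1 h₁).1 s
    have hpost := (fires_iff.1 h₁).2.1 s
    have hmem := (fires_iff.1 h₂).2.2 s
    grind

theorem Fires.swap (hab : N.alphabet.indep a b) (h₁ : N.Fires m a m₁) (h₂ : N.Fires m₁ b m₂) :
    ∃ m', N.Fires m b m' ∧ N.Fires m' a m₂ := by
  refine ⟨(m \ N.pre b) ∪ N.post b, fires_iff.2 ⟨?_, ?_, fun s => Iff.rfl⟩,
    fires_iff.2 ⟨?_, ?_, ?_⟩⟩ <;>
  · intro s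
    have hdisj := not_mem_of_indep hab s
    have hpre₁ := (fires_iff.1 h₁).1 s
    have hpost₁ := (fires_iff.1 h₁).2.1 s
    have hmem₁ := (fires_iff.1 h₁).2.2 s
    have hpre₂ := (fires_iff.1 h₂).1 s
    have hpost₂ := (fires_iff.1 h₂).2.1 s
    have hmem₂ := (fires_iff.1 h₂).2.2 s
    clear h₁ h₂ hab
    grind

theorem firesWord_iff_labeledWalk : N.FiresWord m₁ σ m₂ ↔ LabeledWalk N.Fires m₁ σ m₂ := by
  induction σ generalizing m₁ with
  | nil => exact Iff.rfl
  | cons a σ ih => exact exists_congr fun _ => and_congr_right' ih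

theorem labeledWalk_fires_swap (hab : N.alphabet.indep a b) (h : LabeledWalk N.Fires m₁ [a, b] m₂) :
    LabeledWalk N.Fires m₁ [b, a] m₂ := by
  obtain ⟨m, ha, m', hb, rfl⟩ := h
  obtain ⟨m'', hb', ha'⟩ := ha.swap hab hb
  exact ⟨m'', hb', m', ha', rfl⟩

theorem Fires.exists_of_labeledWalk (h : N.Fires m a m₁) (hσ : LabeledWalk N.Fires m σ m₂)
    (hind : ∀ x ∈ σ, N.alphabet.indep a x) : ∃ m₃, N.Fires m₂ a m₃ := by
  induction σ generalizing m m₁ with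
  | nil => exact ⟨m₁, (show m = m₂ from hσ) ▸ h⟩
  | cons b σ ih =>
    rw [List.forall_mem_cons] at hind
    obtain ⟨m', hb, hσ⟩ := hσ
    obtain ⟨m₃, h⟩ := h.exists_of_indep hind.1 hb
    exact ih h hσ hind.2

theorem trace_mem_firingTraces_iff :
    N.alphabet.trace σ ∈ N.firingTraces ↔ ∃ m, LabeledWalk N.Fires N.initial σ m :=
  ⟨fun ⟨_, m, h, heq⟩ => ⟨m, (firesWord_iff_labeledWalk.1 h).of_trace_eq
    (fun _ _ _ _ => labeledWalk_fires_swap) heq⟩,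
    fun ⟨m, h⟩ => ⟨σ, m, firesWord_iff_labeledWalk.2 h, rfl⟩⟩

variable {s t : N.alphabet.Trace}

theorem one_mem_firingTraces : 1 ∈ N.firingTraces :=
  trace_mem_firingTraces_iff (σ := []).2 ⟨_, rfl⟩

theorem mem_firingTraces_of_dvd (ht : t ∈ N.firingTraces) (h : s ∣ t) : s ∈ N.firingTraces := by
  obtain ⟨r, rfl⟩ := h
  obtain ⟨σ, rfl⟩ := N.alphabet.exists_trace s
  obtain ⟨ρ, rfl⟩ := N.alphabet.exists_trace r
  obtain ⟨m, hm⟩ := trace_mem_firingTraces_iff.1 ht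
  obtain ⟨m₁, hσ, -⟩ := LabeledWalk.append_iff.1 hm
  exact trace_mem_firingTraces_iff.2 ⟨m₁, hσ⟩

theorem mul_singleton_mem_firingTraces (ha : t * N.alphabet.trace [a] ∈ N.firingTraces)
    (hσ : t * N.alphabet.trace σ ∈ N.firingTraces) (hind : ∀ x ∈ σ, N.alphabet.indep a x) :
    t * N.alphabet.trace σ * N.alphabet.trace [a] ∈ N.firingTraces := by
  obtain ⟨τ, rfl⟩ := N.alphabet.exists_trace t
  obtain ⟨m₁, h₁⟩ := trace_mem_firingTraces_iff.1 ha
  obtain ⟨m₂, h₂⟩ := trace_mem_firingTraces_iff.1 hσ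
  obtain ⟨m, hm, ha⟩ := LabeledWalk.append_iff.1 h₁
  obtain ⟨m', hm', hσ⟩ := LabeledWalk.append_iff.1 h₂
  obtain rfl : m = m' := hm.unique (fun _ _ _ _ h h' => h.unique h') hm'
  obtain ⟨m₃, h₃⟩ := (LabeledWalk.singleton_iff.1 ha).exists_of_labeledWalk hσ hind
  exact trace_mem_firingTraces_iff (σ := τ ++ σ ++ [a]).2
    ⟨m₃, LabeledWalk.append_iff.2 ⟨m₂, h₂, LabeledWalk.singleton_iff.2 h₃⟩⟩

/-- The labeled edges of the graph of firing traces: `t` extends `s` by the letter `a`. -/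
def ExtendsBy (s : N.firingTraces) (a : T) (t : N.firingTraces) : Prop :=
  s.1 * N.alphabet.trace [a] = t.1

theorem labeledWalk_extendsBy_iff {s t : N.firingTraces} :
    LabeledWalk ExtendsBy s σ t ↔ s.1 * N.alphabet.trace σ = t.1 := by
  induction σ generalizing s with
  | nil => rw [TraceAlphabet.trace_nil, mul_one, Subtype.coe_inj]; exact Iff.rfl
  | cons a σ ih =>
    rw [TraceAlphabet.trace_cons, ← mul_assoc]
    constructor
    · rintro ⟨r, hr, hσ⟩
      rw [hr, ih.1 hσ]
    · intro h
      have hfiring : s.1 * N.alphabet.trace [a] ∈ N.firingTraces :=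
        mem_firingTraces_of_dvd t.2 ⟨_, h.symm⟩
      exact ⟨⟨_, hfiring⟩, rfl, ih.2 h⟩

/-! ### The domain of the event structure unfolding -/

variable [Finite T]

/-- The firing trace which, by definition, an event of the unfolding is. -/
def firingTrace (e : N.unfolding.Event) : N.firingTraces := ⟨e.1, e.2.1⟩

variable {s t : N.firingTraces} {e e' : N.unfolding.Event} {p : N.alphabet.Trace}

theorem firingTrace_injective : Function.Injective (firingTrace : N.unfolding.Event → _) :=
  fun _ _ h => Subtype.ext (Subtype.mk.inj h)

theorem isPrimeEndingIn_firingTrace (e : N.unfolding.Event) :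
    TraceAlphabet.IsPrimeEndingIn (firingTrace e).1 (N.unfolding.label e) :=
  e.2.2.choose_spec

theorem exists_firingTrace_eq (ht : TraceAlphabet.IsPrimeEndingIn t.1 a) :
    ∃ e : N.unfolding.Event, firingTrace e = t ∧ N.unfolding.label e = a := by
  obtain ⟨s, hs⟩ := (isPrimeEndingIn_firingTrace ⟨t.1, t.2, a, ht⟩).exists_eq_mul
  exact ⟨_, rfl, ht.eq_of_eq_mul hs⟩

theorem unfolding_le_iff : N.unfolding.le e e' ↔ (firingTrace e).1 ∣ (firingTrace e').1 :=
  TraceAlphabet.prefix_iff_dvd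

theorem not_unfolding_conflict_iff :
    ¬ N.unfolding.conflict e e' ↔
      ∃ t : N.firingTraces, (firingTrace e).1 ∣ t.1 ∧ (firingTrace e').1 ∣ t.1 := by
  refine not_not.trans ⟨fun ⟨t, ht, h, h'⟩ => ⟨⟨t, ht⟩, ?_, ?_⟩,
    fun ⟨t, h, h'⟩ => ⟨t.1, t.2, ?_, ?_⟩⟩
  exacts [TraceAlphabet.prefix_iff_dvd.1 h, TraceAlphabet.prefix_iff_dvd.1 h',
    TraceAlphabet.prefix_iff_dvd.2 h, TraceAlphabet.prefix_iff_dvd.2 h']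

/-- The configuration of the unfolding that consists of the prime prefixes of a firing trace. -/
def primeConfig (t : N.firingTraces) : N.unfolding.Config where
  carrier := {e | (firingTrace e).1 ∣ t.1}
  finite := by
    have hfin := N.alphabet.finite_prefix t.1
    simp only [TraceAlphabet.prefix_iff_dvd] at hfin
    exact hfin.preimage (f := fun e => (firingTrace e).1)
      (Subtype.val_injective.comp firingTrace_injective).injOn
  conflictFree _ he _ he' := not_unfolding_conflict_iff.2 ⟨t, he, he'⟩
  downClosed _ he _ hle := (unfolding_le_iff.1 hle).trans he

theorem mem_primeConfig_iff : e ∈ (primeConfig t).carrier ↔ (firingTrace e).1 ∣ t.1 := Iff.rfl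

theorem unfolding_below_eq (e : N.unfolding.Event) :
    N.unfolding.below e = primeConfig (firingTrace e) :=
  LabeledEventStructure.Config.ext_carrier (Set.ext fun _ => unfolding_le_iff)

theorem primeConfig_injective : Function.Injective (primeConfig : N.firingTraces → _) := by
  have hdvd : ∀ s t : N.firingTraces, primeConfig s = primeConfig t → s.1 ∣ t.1 := by
    refine fun s t h => TraceAlphabet.dvd_of_forall_isPrimeEndingIn_dvd fun p a hp hps => ?_
    obtain ⟨e, he, -⟩ := exists_firingTrace_eq (t := ⟨p, mem_firingTraces_of_dvd s.2 hps⟩) hp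
    have hes : e ∈ (primeConfig s).carrier := by rwa [mem_primeConfig_iff, he]
    rwa [h, mem_primeConfig_iff, he] at hes
  exact fun s t h => Subtype.ext (TraceAlphabet.dvd_antisymm (hdvd s t h) (hdvd t s h.symm))

theorem primeConfig_eq_emptyConfig (ht : t.1 = 1) :
    primeConfig t = N.unfolding.emptyConfig := by
  refine LabeledEventStructure.Config.ext_carrier (Set.eq_empty_of_forall_notMem fun e he => ?_)
  exact (isPrimeEndingIn_firingTrace e).not_dvd_one (ht ▸ mem_primeConfig_iff.1 he)

theorem ExtendsBy.carrier_primeConfig (h : ExtendsBy s (N.unfolding.label e) t)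
    (he : (firingTrace e).1 = p * N.alphabet.trace [N.unfolding.label e])
    (hs : s.1 = p * N.alphabet.trace σ) (hσ : ∀ x ∈ σ, N.alphabet.indep (N.unfolding.label e) x) :
    (primeConfig t).carrier = insert e (primeConfig s).carrier := by
  ext e'
  rw [mem_primeConfig_iff, Set.mem_insert_iff, mem_primeConfig_iff, ← h, hs,
    (isPrimeEndingIn_firingTrace e').dvd_mul_iff (he ▸ isPrimeEndingIn_firingTrace e) hσ, ← he,
    Subtype.coe_inj, firingTrace_injective.eq_iff]

theorem ExtendsBy.hasseEdge_primeConfig (h : ExtendsBy s a t) :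
    N.unfolding.HasseEdge (primeConfig s) a (primeConfig t) := by
  obtain ⟨p, ρ, hs, hρ, hp⟩ := TraceAlphabet.exists_isPrimeEndingIn s.1 a
  have hpt : p * N.alphabet.trace [a] ∈ N.firingTraces := by
    refine mem_firingTraces_of_dvd t.2 ?_
    rw [← h, hs]
    exact TraceAlphabet.mul_singleton_dvd_mul_trace_mul hρ
  obtain ⟨e, he, rfl⟩ := exists_firingTrace_eq (t := ⟨_, hpt⟩) hp
  have he' := congrArg Subtype.val he
  refine ⟨e, fun hes => ?_, h.carrier_primeConfig he' hs hρ, rfl⟩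
  rw [mem_primeConfig_iff, he', hs] at hes
  exact TraceAlphabet.not_mul_singleton_dvd_mul_trace hρ hes

theorem exists_firingTrace_eq_mul_of_hasseEdge {c : N.unfolding.Config}
    (hes : e ∉ (primeConfig s).carrier)
    (hc : c.carrier = insert e (primeConfig s).carrier) :
    ∃ p σ, (firingTrace e).1 = p * N.alphabet.trace [N.unfolding.label e] ∧
      s.1 = p * N.alphabet.trace σ ∧ ∀ x ∈ σ, N.alphabet.indep (N.unfolding.label e) x := by
  have hprime := isPrimeEndingIn_firingTrace e
  obtain ⟨p, hp⟩ := hprime.exists_eq_mul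
  have hps : p ∣ s.1 := by
    refine TraceAlphabet.dvd_of_forall_isPrimeEndingIn_dvd fun q b hq hqp => ?_
    have hqe : q ∣ (firingTrace e).1 := hp ▸ hqp.trans (Dvd.intro _ rfl)
    obtain ⟨e', he', -⟩ :=
      exists_firingTrace_eq (t := ⟨q, mem_firingTraces_of_dvd (firingTrace e).2 hqe⟩) hq
    have hec : e ∈ c.carrier := hc.ge (Set.mem_insert e _)
    have hle : N.unfolding.le e' e := unfolding_le_iff.2 (by rwa [he'])
    rcases hc.le (c.downClosed e hec e' hle) with rfl | hmem
    · have hpp : p * N.alphabet.trace [N.unfolding.label e'] ∣ p * N.alphabet.trace [] := by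
        rwa [← hp, he', TraceAlphabet.trace_nil, mul_one]
      exact absurd hpp (TraceAlphabet.not_mul_singleton_dvd_mul_trace (by simp))
    · rwa [mem_primeConfig_iff, he'] at hmem
  obtain ⟨r, hr⟩ := hps
  obtain ⟨ρ, rfl⟩ := N.alphabet.exists_trace r
  refine ⟨p, ρ, hp, hr, (hp ▸ hprime).forall_indep_of_compatible ?_ fun q b hq hqs => ?_⟩
  · rwa [← hp, ← hr]
  · obtain ⟨e', he', -⟩ :=
      exists_firingTrace_eq (t := ⟨q, mem_firingTraces_of_dvd s.2 (hr ▸ hqs)⟩) hq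
    have he's : e' ∈ (primeConfig s).carrier := by
      rw [mem_primeConfig_iff, he']
      exact hqs.trans (dvd_of_eq hr.symm)
    obtain ⟨t, ht', ht⟩ := not_unfolding_conflict_iff.1 (c.conflictFree e'
      (hc.ge (Set.mem_insert_of_mem e he's)) e (hc.ge (Set.mem_insert e _)))
    exact ⟨t.1, by rwa [he'] at ht', hp ▸ ht⟩

theorem exists_extendsBy_of_hasseEdge_primeConfig {c : N.unfolding.Config}
    (h : N.unfolding.HasseEdge (primeConfig s) a c) :
    ∃ t, ExtendsBy s a t ∧ primeConfig t = c := by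
  obtain ⟨e, hes, hc, rfl⟩ := h
  obtain ⟨p, σ, he, hs, hσ⟩ := exists_firingTrace_eq_mul_of_hasseEdge hes hc
  have hfiring := mul_singleton_mem_firingTraces (he ▸ (firingTrace e).2) (hs ▸ s.2) hσ
  have hext : ExtendsBy s (N.unfolding.label e) ⟨_, hfiring⟩ :=
    congrArg (· * N.alphabet.trace [N.unfolding.label e]) hs
  exact ⟨_, hext, LabeledEventStructure.Config.ext_carrier
    ((hext.carrier_primeConfig he hs hσ).trans hc.symm)⟩

theorem hasseEdge_primeConfig_iff :
    N.unfolding.HasseEdge (primeConfig s) a (primeConfig t) ↔ ExtendsBy s a t := by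
  refine ⟨fun h => ?_, ExtendsBy.hasseEdge_primeConfig⟩
  obtain ⟨t', ht', heq⟩ := exists_extendsBy_of_hasseEdge_primeConfig h
  exact primeConfig_injective heq ▸ ht'

theorem primeConfig_surjective : Function.Surjective (primeConfig : N.firingTraces → _) := by
  have hwalk : ∀ σ (s : N.firingTraces) c,
      LabeledWalk N.unfolding.HasseEdge (primeConfig s) σ c → ∃ t, primeConfig t = c := by
    intro σ
    induction σ with
    | nil => exact fun s c h => ⟨s, h⟩
    | cons a σ ih =>
      rintro s c ⟨d, hd, hσ⟩
      obtain ⟨t, -, rfl⟩ := exists_extendsBy_of_hasseEdge_primeConfig hd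
      exact ih t c hσ
  intro c
  obtain ⟨σ, hσ⟩ := LabeledEventStructure.subset_iff_exists_labeledWalk.1
    (show N.unfolding.emptyConfig.carrier ⊆ c.carrier from Set.empty_subset _)
  exact hwalk σ ⟨1, one_mem_firingTraces⟩ c (by rwa [primeConfig_eq_emptyConfig rfl])

/-- The isomorphism between the graph of firing traces and the domain of the unfolding. -/
noncomputable def primeConfigEquiv (N : NetSystem S T) : N.firingTraces ≃ N.unfolding.Config :=
  .ofBijective primeConfig ⟨primeConfig_injective, primeConfig_surjective⟩

theorem hasseEdge_iff_extendsBy_primeConfigEquiv_symm (c : N.unfolding.Config) (a : T)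
    (c' : N.unfolding.Config) :
    N.unfolding.HasseEdge c a c' ↔
      ExtendsBy (N.primeConfigEquiv.symm c) a (N.primeConfigEquiv.symm c') := by
  obtain ⟨s, rfl⟩ := N.primeConfigEquiv.surjective c
  obtain ⟨t, rfl⟩ := N.primeConfigEquiv.surjective c'
  rw [Equiv.symm_apply_apply, Equiv.symm_apply_apply]
  exact hasseEdge_primeConfig_iff

end NetSystem

/-! ### Holonomy in simply connected square complexes -/

namespace DirectedSquareComplex

variable {Λ : Type w} {X : DirectedSquareComplex.{u, v} Λ} {G : Type x} {x y z : X.Vertex}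
  {l l' : List (X.Edge × Bool)} {σ τ : List Λ}

/-- The labeled edges of a complex as a relation on its vertices: the walks of `X.Step` are the
directed paths of `X`. -/
def Step (X : DirectedSquareComplex.{u, v} Λ) (x : X.Vertex) (a : Λ) (y : X.Vertex) : Prop :=
  ∃ e, X.source e = x ∧ X.target e = y ∧ X.label e = a

theorem dirReach_iff_exists_labeledWalk : X.DirReach x y ↔ ∃ σ, LabeledWalk X.Step x σ y := by
  rw [LabeledWalk.exists_iff_reflTransGen]
  have hstep : ∀ x y, (∃ e, X.source e = x ∧ X.target e = y) ↔ ∃ a, X.Step x a y :=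
    fun x y => ⟨fun ⟨e, hx, hy⟩ => ⟨_, e, hx, hy, rfl⟩, fun ⟨_, e, hx, hy, _⟩ => ⟨e, hx, hy⟩⟩
  simp only [DirReach, hstep]

theorem isPath_append (hl : X.IsPath x l y) (hl' : X.IsPath y l' z) : X.IsPath x (l ++ l') z := by
  induction l generalizing x with
  | nil => exact (show x = y from hl) ▸ hl'
  | cons s l ih => exact ⟨hl.1, ih hl.2⟩

section holonomy

variable [Group G] {γ : X.Edge → G}

/-- The product of the weights in a group of the edges of a path, inverted for the edges that are
traversed backwards. -/
def holonomy (γ : X.Edge → G) (l : List (X.Edge × Bool)) : G :=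
  (l.map fun s => if s.2 then γ s.1 else (γ s.1)⁻¹).prod

theorem holonomy_append : holonomy γ (l ++ l') = holonomy γ l * holonomy γ l' := by
  simp [holonomy]

theorem Homotopic.holonomy_eq
    (hγ : ∀ e f e' f', X.IsSquare e f e' f' → γ e * γ f' = γ f * γ e')
    (h : X.Homotopic x y l l') : holonomy γ l = holonomy γ l' := by
  induction h with
  | rel l l' h =>
    rcases h.2.2 with ⟨p, q, ⟨e, b⟩, rfl, rfl⟩ | ⟨p, q, e, f, e', f', hsq, rfl, rfl⟩
    · cases b <;> simp [holonomy]
    · simp only [holonomy, List.map_append, List.map_cons, List.prod_append, List.prod_cons,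
        if_true, ← mul_assoc (γ _) (γ _), hγ e f e' f' hsq]
  | refl => rfl
  | symm _ _ _ ih => exact ih.symm
  | trans _ _ _ _ _ ih ih' => exact ih.trans ih'

theorem SimplyConnected.holonomy_eq (hX : X.SimplyConnected)
    (hγ : ∀ e f e' f', X.IsSquare e f e' f' → γ e * γ f' = γ f * γ e')
    (hl : X.IsPath x l y) (hl' : X.IsPath x l' y) : holonomy γ l = holonomy γ l' := by
  obtain ⟨-, hconnected, hnull⟩ := hX
  obtain ⟨k, hk⟩ := hconnected y x
  have hclosed : ∀ {l}, X.IsPath x l y → holonomy γ l * holonomy γ k = 1 := fun hl => by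
    rw [← holonomy_append]
    exact (hnull x _ (isPath_append hl hk)).holonomy_eq hγ
  exact mul_right_cancel ((hclosed hl).trans (hclosed hl').symm)

theorem exists_isPath_holonomy_eq (f : Λ → G) (h : LabeledWalk X.Step x σ y) :
    ∃ l, X.IsPath x l y ∧ holonomy (fun e => f (X.label e)) l = (σ.map f).prod := by
  induction σ generalizing x with
  | nil => exact ⟨[], h, rfl⟩
  | cons a σ ih =>
    obtain ⟨z, ⟨e, rfl, rfl, rfl⟩, hzy⟩ := h
    obtain ⟨l, hl, hprod⟩ := ih hzy
    refine ⟨(e, true) :: l, ⟨if_pos rfl, hl⟩, ?_⟩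
    rw [List.map_cons, List.prod_cons, ← hprod]
    simp [holonomy]

end holonomy

theorem SimplyConnected.trace_eq (hX : X.SimplyConnected) {M : TraceAlphabet Λ}
    (hM : ∀ e f e' f', X.IsSquare e f e' f' → M.indep (X.label e) (X.label f) ∧
      X.label e' = X.label e ∧ X.label f' = X.label f)
    (hσ : LabeledWalk X.Step x σ y) (hτ : LabeledWalk X.Step x τ y) :
    M.trace σ = M.trace τ := by
  refine M.toGroup_injective ?_
  have hγ : ∀ e f e' f', X.IsSquare e f e' f' →
      M.toGroup (M.trace [X.label e]) * M.toGroup (M.trace [X.label f']) =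
        M.toGroup (M.trace [X.label f]) * M.toGroup (M.trace [X.label e']) := by
    intro e f e' f' hsq
    obtain ⟨hindep, he', hf'⟩ := hM e f e' f' hsq
    rw [he', hf']
    exact (TraceAlphabet.commute_trace_singleton hindep).map M.toGroup
  obtain ⟨l, hl, hlσ⟩ := exists_isPath_holonomy_eq (fun a => M.toGroup (M.trace [a])) hσ
  obtain ⟨k, hk, hkτ⟩ := exists_isPath_holonomy_eq (fun a => M.toGroup (M.trace [a])) hτ
  have hhol := hX.holonomy_eq (γ := fun e => M.toGroup (M.trace [X.label e])) hγ hl hk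
  rw [hlσ, hkτ] at hhol
  rw [M.trace_eq_prod, M.trace_eq_prod τ, map_list_prod, map_list_prod, List.map_map,
    List.map_map]
  exact hhol

end DirectedSquareComplex

/-! ### The principal filter in the universal cover -/

theorem LabeledEventStructure.hasDomain_iff {Λ : Type w} {E : LabeledEventStructure.{x} Λ}
    {Y : DirectedSquareComplex.{u, v} Λ} {y : Y.Vertex} :
    E.HasDomain Y y ↔
      ∃ θ : E.Config ≃ Y.filter y, ∀ c a c', E.HasseEdge c a c' ↔ Y.Step (θ c).1 a (θ c').1 := by
  refine ⟨fun ⟨θ, _, hθ⟩ => ⟨θ, hθ⟩, fun ⟨θ, hθ⟩ => ⟨θ, fun c c' => ?_, hθ⟩⟩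
  have hclosed : ∀ z a z', Y.DirReach y z → Y.Step z a z' → Y.DirReach y z' :=
    fun z a z' hz ⟨ε, hs, ht, _⟩ => hz.tail ⟨ε, hs, ht⟩
  rw [subset_iff_exists_labeledWalk, DirectedSquareComplex.dirReach_iff_exists_labeledWalk]
  exact exists_congr fun σ =>
    (LabeledWalk.map_equiv_iff θ hθ).trans (LabeledWalk.subtype_iff hclosed)

namespace NetSystem

variable {S : Type u} {T : Type v} {N : NetSystem S T} {Y : DirectedSquareComplex.{u₂, v₂} T}
  {φ : DirectedSquareComplex.Hom Y N.complex} {y y₀ z z' : Y.Vertex} {a b : T} {σ τ : List T}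

/-- The end of an arc that starts in the marking graph. -/
def Marking.next (m : N.Marking) {m' : Set S} (h : N.Fires m.1 a m') : N.Marking :=
  ⟨m', m.2.trans _ _ _ (.rel _ _ ⟨a, h⟩)⟩

theorem Arc.ext_of_source_of_action {e f : N.Arc} (hsource : e.source = f.source)
    (haction : e.action = f.action) : e = f := by
  obtain ⟨m, a, m₁, h₁⟩ := e
  obtain ⟨m', a', m₂, h₂⟩ := f
  obtain rfl : m = m' := hsource
  obtain rfl : a = a' := haction
  obtain rfl : m₁ = m₂ := Subtype.ext (h₁.unique h₂)
  rfl

theorem exists_isSquare {e f' : N.Arc} (h : e.target = f'.source)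
    (hindep : N.alphabet.indep e.action f'.action) :
    ∃ f e', N.complex.IsSquare e f e' f' := by
  obtain ⟨m, hm, hm'⟩ := e.fires.swap hindep (h ▸ f'.fires)
  exact ⟨⟨e.source, f'.action, e.source.next hm, hm⟩, ⟨e.source.next hm, e.action, f'.target, hm'⟩,
    hindep, rfl, rfl, rfl, h, rfl, rfl⟩

theorem fires_of_step (φ : DirectedSquareComplex.Hom Y N.complex) (h : Y.Step y a z) :
    N.Fires (φ.onVertex y).1 a (φ.onVertex z).1 := by
  obtain ⟨e, rfl, rfl, rfl⟩ := h
  rw [← φ.source_onEdge, ← φ.target_onEdge, ← φ.label_onEdge]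
  exact (φ.onEdge e).fires

theorem exists_step_of_fires (hφ : φ.IsCovering) {m : Set S} (h : N.Fires (φ.onVertex y).1 a m) :
    ∃ z, Y.Step y a z ∧ (φ.onVertex z).1 = m := by
  obtain ⟨e, he, hφe⟩ := (hφ.outgoing y).surjOn
    (show (⟨φ.onVertex y, a, (φ.onVertex y).next h, h⟩ : N.Arc) ∈ _ from rfl)
  refine ⟨Y.target e, ⟨e, he, rfl, ?_⟩, ?_⟩
  · rw [← φ.label_onEdge, hφe]
    rfl
  · rw [← φ.target_onEdge, hφe]
    rfl

theorem step_unique (hφ : φ.IsCovering) (hz : Y.Step y a z) (hz' : Y.Step y a z') : z = z' := by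
  obtain ⟨e, he, rfl, hea⟩ := hz
  obtain ⟨e', he', rfl, hea'⟩ := hz'
  refine congrArg Y.target ((hφ.outgoing y).injOn he he' (Arc.ext_of_source_of_action ?_ ?_))
  · exact (hφ.outgoing y).mapsTo he |>.trans ((hφ.outgoing y).mapsTo he').symm
  · exact (φ.label_onEdge e).trans (hea.trans (hea'.symm.trans (φ.label_onEdge e').symm))

theorem labeledWalk_step_swap (hφ : φ.IsCovering) (hindep : N.alphabet.indep a b)
    (h : LabeledWalk Y.Step y [a, b] z) : LabeledWalk Y.Step y [b, a] z := by
  obtain ⟨_, ⟨e, rfl, rfl, rfl⟩, _, ⟨f', hf', rfl, rfl⟩, rfl⟩ := h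
  have htarget : (φ.onEdge e).target = (φ.onEdge f').source :=
    (φ.target_onEdge e).trans ((congrArg φ.onVertex hf'.symm).trans (φ.source_onEdge f').symm)
  rw [← φ.label_onEdge, ← φ.label_onEdge] at hindep
  obtain ⟨f, e', hsq⟩ := exists_isSquare htarget hindep
  obtain ⟨d, g, d', g', hlift, hd, hde, rfl, rfl, hgf⟩ :=
    hφ.square_at_source _ _ _ _ _ hsq (φ.source_onEdge e)
  obtain rfl : d = e := (hφ.outgoing _).injOn hd rfl hde
  have hside := Y.square_side _ _ _ _ hlift
  obtain rfl : g' = f' := (hφ.outgoing _).injOn hside.symm hf' hgf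
  obtain ⟨-, hlabel, hlabel', -⟩ := hsq
  refine ⟨Y.target g, ⟨g, (Y.square_source _ _ _ _ hlift).symm, rfl, ?_⟩, _,
    ⟨d', (Y.square_side _ _ _ _ (Y.square_swap _ _ _ _ hlift)).symm,
      Y.square_sink _ _ _ _ hlift, ?_⟩, rfl⟩
  · rw [← φ.label_onEdge, ← φ.label_onEdge]
    exact hlabel'.symm
  · rw [← φ.label_onEdge, ← φ.label_onEdge]
    exact hlabel

theorem exists_labeledWalk_step (hφ : φ.IsCovering) {m : Set S}
    (h : LabeledWalk N.Fires (φ.onVertex y).1 σ m) : ∃ z, LabeledWalk Y.Step y σ z := by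
  induction σ generalizing y with
  | nil => exact ⟨y, rfl⟩
  | cons a σ ih =>
    obtain ⟨m₁, ha, hσ⟩ := h
    obtain ⟨y₁, hy₁, rfl⟩ := exists_step_of_fires hφ ha
    obtain ⟨z, hz⟩ := ih hσ
    exact ⟨z, y₁, hy₁, hz⟩

theorem labeledWalk_step_iff_trace_eq (hφ : φ.IsUniversalCover) (hσ : LabeledWalk Y.Step y σ z) :
    LabeledWalk Y.Step y τ z ↔ N.alphabet.trace τ = N.alphabet.trace σ := by
  refine ⟨fun hτ => hφ.2.trace_eq (fun e f e' f' hsq => ?_) hτ hσ,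
    fun h => hσ.of_trace_eq (fun _ _ _ _ => labeledWalk_step_swap hφ.1) h.symm⟩
  obtain ⟨hindep, he', hf', -⟩ := φ.square_onEdge e f e' f' hsq
  rw [← φ.label_onEdge, ← φ.label_onEdge, ← φ.label_onEdge, ← φ.label_onEdge]
  exact ⟨hindep, he', hf'⟩

theorem exists_firingTrace_labeledWalk_step_iff (hφ : φ.IsUniversalCover)
    (hy₀ : φ.onVertex y₀ = N.initialMarking) (x : Y.filter y₀) :
    ∃ t : N.firingTraces, ∀ σ, LabeledWalk Y.Step y₀ σ x.1 ↔ N.alphabet.trace σ = t.1 := by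
  obtain ⟨σ, hσ⟩ := DirectedSquareComplex.dirReach_iff_exists_labeledWalk.1 x.2
  have hfires := hσ.map (fun y => (φ.onVertex y).1) fun _ _ _ => fires_of_step φ
  rw [hy₀] at hfires
  exact ⟨⟨N.alphabet.trace σ, trace_mem_firingTraces_iff.2 ⟨_, hfires⟩⟩,
    fun τ => labeledWalk_step_iff_trace_eq hφ hσ⟩

theorem exists_filter_equiv_firingTraces (hφ : φ.IsUniversalCover)
    (hy₀ : φ.onVertex y₀ = N.initialMarking) :
    ∃ h : Y.filter y₀ ≃ N.firingTraces, ∀ x a x', Y.Step x.1 a x'.1 ↔ ExtendsBy (h x) a (h x') := by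
  have hstep : ∀ x a y z, Y.Step x a y → Y.Step x a z → y = z :=
    fun _ _ _ _ => step_unique hφ.1
  choose h hwalk using exists_firingTrace_labeledWalk_step_iff hφ hy₀
  refine ⟨.ofBijective h ⟨fun x x' hxx' => Subtype.ext ?_, fun t => ?_⟩, fun x a x' => ?_⟩
  · obtain ⟨σ, hσ⟩ := N.alphabet.exists_trace (h x).1
    exact ((hwalk x σ).2 hσ).unique hstep ((hwalk x' σ).2 (hxx' ▸ hσ))
  · obtain ⟨σ, hσ⟩ := N.alphabet.exists_trace t.1
    obtain ⟨m, hm⟩ := trace_mem_firingTraces_iff.1 (hσ ▸ t.2)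
    obtain ⟨y, hy⟩ := exists_labeledWalk_step (y := y₀) hφ.1 (by rwa [hy₀])
    refine ⟨⟨y, DirectedSquareComplex.dirReach_iff_exists_labeledWalk.2 ⟨σ, hy⟩⟩, Subtype.ext ?_⟩
    exact ((hwalk _ σ).1 hy).symm.trans hσ
  · obtain ⟨σ, hσ⟩ := N.alphabet.exists_trace (h x).1
    have hx := (hwalk x σ).2 hσ
    have happend : LabeledWalk Y.Step y₀ (σ ++ [a]) x'.1 ↔ Y.Step x.1 a x'.1 := by
      rw [LabeledWalk.append_iff, ← LabeledWalk.singleton_iff (R := Y.Step)]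
      exact ⟨fun ⟨z, hz, ha⟩ => hx.unique hstep hz ▸ ha, fun ha => ⟨_, hx, ha⟩⟩
    rw [← happend, hwalk, TraceAlphabet.trace_append, hσ]
    rfl

theorem hasDomain_iff_exists_equiv_firingTraces (hφ : φ.IsUniversalCover)
    (hy₀ : φ.onVertex y₀ = N.initialMarking) {E : LabeledEventStructure.{w} T} :
    E.HasDomain Y y₀ ↔ ∃ g : E.Config ≃ N.firingTraces,
      ∀ c a c', E.HasseEdge c a c' ↔ ExtendsBy (g c) a (g c') := by
  obtain ⟨h, hh⟩ := exists_filter_equiv_firingTraces hφ hy₀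
  rw [LabeledEventStructure.hasDomain_iff]
  refine ⟨fun ⟨θ, hθ⟩ => ⟨θ.trans h, fun c a c' => (hθ c a c').trans (hh _ _ _)⟩,
    fun ⟨g, hg⟩ => ⟨g.trans h.symm, fun c a c' => ?_⟩⟩
  rw [hg, hh]
  simp

/-! ### Event structures whose domain is the graph of firing traces -/

section domain

variable {E : LabeledEventStructure.{w} T} {g : E.Config ≃ N.firingTraces} {c : E.Config}
  (hg : ∀ c a c', E.HasseEdge c a c' ↔ ExtendsBy (g c) a (g c'))
include hg

theorem apply_emptyConfig_eq_one : (g E.emptyConfig).1 = 1 := by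
  obtain ⟨σ, hσ⟩ := LabeledEventStructure.subset_iff_exists_labeledWalk.1
    (show E.emptyConfig.carrier ⊆ (g.symm ⟨1, one_mem_firingTraces⟩).carrier from
      Set.empty_subset _)
  rw [LabeledWalk.map_equiv_iff g hg, g.apply_symm_apply, labeledWalk_extendsBy_iff] at hσ
  exact TraceAlphabet.dvd_antisymm (Dvd.intro _ hσ) (one_dvd _)

theorem isGeodesicWord_iff_trace_eq : E.IsGeodesicWord c σ ↔ N.alphabet.trace σ = (g c).1 := by
  rw [LabeledEventStructure.isGeodesicWord_iff, LabeledWalk.map_equiv_iff g hg,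
    labeledWalk_extendsBy_iff, apply_emptyConfig_eq_one hg, one_mul]

theorem geodesicTraces_eq_firingTraces : E.geodesicTraces N.alphabet = N.firingTraces := by
  ext t
  constructor
  · rintro ⟨c, σ, hσ, rfl⟩
    rw [(isGeodesicWord_iff_trace_eq hg).1 hσ]
    exact (g c).2
  · intro ht
    obtain ⟨σ, rfl⟩ := N.alphabet.exists_trace t
    refine ⟨g.symm ⟨_, ht⟩, σ, (isGeodesicWord_iff_trace_eq hg).2 ?_, rfl⟩
    rw [g.apply_symm_apply]

theorem exists_iso_unfolding [Finite T] :
    ∃ f : N.unfolding.Iso E, ∀ e : N.unfolding.Event, (g (E.below (f.toEquiv e))).1 = e.1 := by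
  let θ := N.primeConfigEquiv.symm.trans g.symm
  have hθ : ∀ c a c', N.unfolding.HasseEdge c a c' ↔ E.HasseEdge (θ c) a (θ c') := by
    intro c a c'
    rw [hasseEdge_iff_extendsBy_primeConfigEquiv_symm, hg]
    simp [θ]
  obtain ⟨f, hf⟩ := LabeledEventStructure.exists_iso_of_hasseEdge_iff θ hθ
  refine ⟨f, fun e => ?_⟩
  have hbelow : N.unfolding.below e = N.primeConfigEquiv (firingTrace e) := unfolding_below_eq e
  simp [hf, θ, hbelow, firingTrace]

end domain

end NetSystem

theorem mainTheorem2_general {S : Type u} {T : Type v} [Finite T] (N : NetSystem S T)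
    (Y : DirectedSquareComplex.{u₂, v₂} T) (φ : DirectedSquareComplex.Hom Y N.complex)
    (hφ : φ.IsUniversalCover)
    (y₀ : Y.Vertex) (hy₀ : φ.onVertex y₀ = N.initialMarking) :
    (∃ E' : LabeledEventStructure.{v} T, E'.HasDomain Y y₀) ∧
    ∀ E' : LabeledEventStructure.{w} T, E'.HasDomain Y y₀ →
      E'.geodesicTraces N.alphabet = N.firingTraces ∧
      ∃ (g : E'.Config ≃ N.firingTraces) (f : N.unfolding.Iso E'),
        (∀ (c : E'.Config) (σ : List T),
          E'.IsGeodesicWord c σ ↔ N.alphabet.trace σ = (g c).1) ∧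
        ∀ e : N.unfolding.Event, (g (E'.below (f.toEquiv e))).1 = e.1 := by
  refine ⟨⟨N.unfolding, (NetSystem.hasDomain_iff_exists_equiv_firingTraces hφ hy₀).2
    ⟨_, NetSystem.hasseEdge_iff_extendsBy_primeConfigEquiv_symm⟩⟩, fun E' hE' => ?_⟩
  obtain ⟨g, hg⟩ := (NetSystem.hasDomain_iff_exists_equiv_firingTraces hφ hy₀).1 hE'
  obtain ⟨f, hf⟩ := NetSystem.exists_iso_unfolding hg
  exact ⟨NetSystem.geodesicTraces_eq_firingTraces hg, g, f,
    fun c σ => NetSystem.isGeodesicWord_iff_trace_eq hg, hf⟩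

theorem mainTheorem2 {S : Type u} {T : Type v} [Finite S] [Finite T] (N : NetSystem S T)
    (Y : DirectedSquareComplex.{u₂, v₂} T) (φ : DirectedSquareComplex.Hom Y N.complex)
    (hφ : φ.IsUniversalCover)
    (y₀ : Y.Vertex) (hy₀ : φ.onVertex y₀ = N.initialMarking) :
    (∃ E' : LabeledEventStructure.{v} T, E'.HasDomain Y y₀) ∧
    ∀ E' : LabeledEventStructure.{w} T, E'.HasDomain Y y₀ →
      E'.geodesicTraces N.alphabet = N.firingTraces ∧
      ∃ (g : E'.Config ≃ N.firingTraces) (f : N.unfolding.Iso E'),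
        (∀ (c : E'.Config) (σ : List T),
          E'.IsGeodesicWord c σ ↔ N.alphabet.trace σ = (g c).1) ∧
        ∀ e : N.unfolding.Event, (g (E'.below (f.toEquiv e))).1 = e.1 := by
  exact mainTheorem2_general N Y φ hφ y₀ hy₀
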